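/- **Setting.** Manifolds are smooth, finite-dimensional, Hausdorff and second countable; $C^\infty(\cdot)$ denotes smooth complex-valued functions. $\operatorname{DiffOp}(M)$ is the algebra of differential operators of finite order on $C^\infty(M)$, and bidifferential operators are bilinear maps that are differential operators of finite (bounded) order in each argument. A *star product* on $M$ is an associative $\mathbb{C}[[\lambda]]$-bilinear product $f\star g=\sum_{k\ge 0}\lambda^k C_k(f,g)$ on $C^\infty(M)[[\lambda]]$ with bidifferential operators $C_k$, $C_0(f,g)=fg$ and $1\star f=f=f\star 1$. Its Poisson bracket is $\{f,g\}=\frac{i}{2}(C_1(f,g)-C_1(g,f))$, and $\star$ is *symplectic* if this Poisson structure is nondegenerate at every point of $M$. A *fibered manifold* is a smooth surjective submersion $\operatorname{pr}:P\to M$. An *sP-bracket* on $P$ is a bidifferential operator $\{\!\{\cdot,\cdot\}\!\}:C^\infty(M)\times C^\infty(P)\to C^\infty(P)$ (with $C^\infty(M)$ acting on $C^\infty(P)$ through $\operatorname{pr}^*$) such that for all $a,b\in C^\infty(M)$, $f\in C^\infty(P)$ 1. $\{\!\{ab,f\}\!\}=\operatorname{pr}^*a\,\{\!\{b,f\}\!\}+\operatorname{pr}^*b\,\{\!\{a,f\}\!\}$,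 2. $\{\!\{a,\operatorname{pr}^*b\,f\}\!\}=\operatorname{pr}^*\{a,b\}\,f+\operatorname{pr}^*b\,\{\!\{a,f\}\!\}$, 3. $\{\!\{a,\{\!\{b,f\}\!\}\}\!\}-\{\!\{b,\{\!\{a,f\}\!\}\}\!\}-\{\!\{\{a,b\},f\}\!\}=0$. A *bimodule deformation* of $\operatorname{pr}:P\to M$ consists of operations $a\bullet f=\sum_k\lambda^kL_k(a,f)$ and $f\bullet' a=\sum_k\lambda^kR_k(f,a)$ with bidifferential operators $L_k,R_k$ and $L_0(a,f)=R_0(f,a)=\operatorname{pr}^*a\,f$, which, extended $\mathbb{C}[[\lambda]]$-bilinearly, make $C^\infty(P)[[\lambda]]$ a unital left, respectively right, $(C^\infty(M)[[\lambda]],\star)$-module and satisfy $(a\bullet f)\bullet' b=a\bullet(f\bullet' b)$. **Theorem.** Let $\star$ be a symplectic star product on $M$, let $\operatorname{pr}:P\to M$ be a fibered manifold and let $\{\!\{\cdot,\cdot\}\!\}$ be an sP-bracket on $P$. Then there is exactly one morphism of unital $\mathbb{C}$-algebras $\Phi:\operatorname{DiffOp}(M)\to\operatorname{DiffOp}(P)$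 which maps multiplication by $a$ to multiplication by $\operatorname{pr}^*a$ and the Hamiltonian vector field $X_a=\{a,\cdot\}$ to $\{\!\{a,\cdot\}\!\}$, for every $a\in C^\infty(M)$; and $$L_k(a,f):=\Phi\bigl(C_k(a,\cdot)\bigr)(f),\qquad R_k(f,a):=\Phi\bigl(C_k(\cdot,a)\bigr)(f)$$ define a bimodule deformation of $P$. In particular, a bimodule deformation exists. -/

import Mathlib

open scoped Manifold ContDiff PowerSeries

noncomputable section

namespace FiberedDeformation

/-! ### Differential operators, in the algebraic (Grothendieck) sense -/

section Algebraic

variable {A B : Type*} [CommRing A] [Algebra ℂ A] [CommRing B] [Algebra ℂ B]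

/-- The commutator `b ↦ D (a * b) - φ a * D b` of a linear map `D : A → B` with multiplication by
`a`, where `A` acts on `B` through `φ`. -/
def comm (φ : A →ₐ[ℂ] B) (D : A →ₗ[ℂ] B) (a : A) : A →ₗ[ℂ] B :=
  D ∘ₗ LinearMap.mulLeft ℂ a - LinearMap.mulLeft ℂ (φ a) ∘ₗ D

/-- `IsDiffOp φ k D`: the linear map `D : A → B` is a differential operator of order at most `k`
along `φ : A → B`. Order at most `0` means `A`-linear, order at most `k + 1` means that all
commutators with multiplications have order at most `k`.
For `A = B = C^∞(M)` and `φ = id` these are the usual differential operators on `M`; for `φ` the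
pullback along `pr : P → M` they are the differential operators
`a ↦ ∑_I c_I pr^*(∂_I a)` with `c_I ∈ C^∞(P)`. -/
def IsDiffOp (φ : A →ₐ[ℂ] B) : ℕ → (A →ₗ[ℂ] B) → Prop
  | 0, D => ∀ a b : A, D (a * b) = φ a * D b
  | k + 1, D => ∀ a : A, IsDiffOp φ k (comm φ D a)

theorem IsDiffOp.succ {φ : A →ₐ[ℂ] B} {k : ℕ} :
    ∀ {D : A →ₗ[ℂ] B}, IsDiffOp φ k D → IsDiffOp φ (k + 1) D := by
  induction k with
  | zero =>
    intro D h a b c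
    have h' : ∀ a b : A, D (a * b) = φ a * D b := h
    simp only [comm, LinearMap.sub_apply, LinearMap.comp_apply, LinearMap.mulLeft_apply, h',
      sub_self, mul_zero]
  | succ k ih => exact fun h a => ih (h a)

theorem IsDiffOp.mono {φ : A →ₐ[ℂ] B} {k l : ℕ} (hkl : k ≤ l) {D : A →ₗ[ℂ] B}
    (h : IsDiffOp φ k D) : IsDiffOp φ l D := by
  induction hkl with
  | refl => exact h
  | step _ ih => exact ih.succ

theorem IsDiffOp.add {φ : A →ₐ[ℂ] B} {k : ℕ} :
    ∀ {D D' : A →ₗ[ℂ] B}, IsDiffOp φ k D → IsDiffOp φ k D' → IsDiffOp φ k (D + D') := by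
  induction k with
  | zero =>
    intro D D' h h' a b
    have h1 : ∀ a b : A, D (a * b) = φ a * D b := h
    have h2 : ∀ a b : A, D' (a * b) = φ a * D' b := h'
    simp only [LinearMap.add_apply, h1, h2, mul_add]
  | succ k ih =>
    intro D D' h h' a
    have e : comm φ (D + D') a = comm φ D a + comm φ D' a := by
      ext b; simp [comm]; ring
    rw [e]; exact ih (h a) (h' a)

theorem isDiffOp_mulLeft (a : A) :
    IsDiffOp (AlgHom.id ℂ A) 0 (LinearMap.mulLeft ℂ a) := by
  intro b c
  simp only [LinearMap.mulLeft_apply, AlgHom.id_apply]; ring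

theorem IsDiffOp.comp {n : ℕ} : ∀ {k l : ℕ} {D D' : A →ₗ[ℂ] A}, k + l = n →
    IsDiffOp (AlgHom.id ℂ A) k D → IsDiffOp (AlgHom.id ℂ A) l D' →
    IsDiffOp (AlgHom.id ℂ A) n (D ∘ₗ D') := by
  induction n with
  | zero =>
    intro k l D D' hn h h' a b
    obtain ⟨rfl, rfl⟩ : k = 0 ∧ l = 0 := by omega
    have h1 : ∀ a b : A, D (a * b) = a * D b := h
    have h2 : ∀ a b : A, D' (a * b) = a * D' b := h'
    simp only [LinearMap.comp_apply, h1, h2, AlgHom.id_apply]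
  | succ n ih =>
    intro k l D D' hn h h' a
    have e : comm (AlgHom.id ℂ A) (D ∘ₗ D') a
        = D ∘ₗ comm (AlgHom.id ℂ A) D' a + comm (AlgHom.id ℂ A) D a ∘ₗ D' := by
      ext b; simp [comm]
    rw [e]
    have z : ∀ {E : A →ₗ[ℂ] A}, IsDiffOp (AlgHom.id ℂ A) 0 E →
        comm (AlgHom.id ℂ A) E a = 0 := by
      intro E hE
      have hE' : ∀ a b : A, E (a * b) = a * E b := hE
      ext b; simp [comm, hE']
    have zero : IsDiffOp (AlgHom.id ℂ A) n (0 : A →ₗ[ℂ] A) :=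
      IsDiffOp.mono (Nat.zero_le n) (fun a b => by simp)
    refine IsDiffOp.add ?_ ?_
    · cases l with
      | zero => rw [z h', LinearMap.comp_zero]; exact zero
      | succ l => exact ih (by omega) h (h' a)
    · cases k with
      | zero => rw [z h, LinearMap.zero_comp]; exact zero
      | succ k => exact ih (by omega) (h a) h'

variable (A) in
/-- The algebra `DiffOp` of differential operators (of finite order) on `A`, under composition. -/
def DiffOp : Subalgebra ℂ (Module.End ℂ A) where
  carrier := {D | ∃ k, IsDiffOp (AlgHom.id ℂ A) k D}
  mul_mem' := by
    rintro D D' ⟨k, h⟩ ⟨l, h'⟩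
    exact ⟨k + l, IsDiffOp.comp rfl h h'⟩
  add_mem' := by
    rintro D D' ⟨k, h⟩ ⟨l, h'⟩
    exact ⟨max k l, (h.mono (le_max_left k l)).add (h'.mono (le_max_right k l))⟩
  algebraMap_mem' := by
    intro c
    refine ⟨0, fun a b => ?_⟩
    simp [Module.algebraMap_end_apply]

/-- Multiplication by `a`, as a differential operator. -/
def mulOp (a : A) : DiffOp A := ⟨LinearMap.mulLeft ℂ a, 0, isDiffOp_mulLeft a⟩

/-- Bidifferential operators `A × A' → B` along `φ : A → B` and `φ' : A' → B`: bilinear maps that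
are of order at most `k` in the first and of order at most `l` in the second argument, for some
`k` and `l`. -/
def IsBidiffOp {A' : Type*} [CommRing A'] [Algebra ℂ A'] (φ : A →ₐ[ℂ] B) (φ' : A' →ₐ[ℂ] B)
    (D : A →ₗ[ℂ] A' →ₗ[ℂ] B) : Prop :=
  ∃ k l : ℕ, (∀ v, IsDiffOp φ k (D.flip v)) ∧ (∀ u, IsDiffOp φ' l (D u))

/-! ### Star products, module deformations and sP-brackets -/

/-- The `λ`-bilinear extension to formal power series of the operation
`(u, v) ↦ ∑_k λ^k D_k(u, v)`. -/
def formalExt {U V W : Type*} [CommRing U] [Algebra ℂ U] [CommRing V] [Algebra ℂ V]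
    [CommRing W] [Algebra ℂ W] (D : ℕ → U →ₗ[ℂ] V →ₗ[ℂ] W) (u : U⟦X⟧) (v : V⟦X⟧) : W⟦X⟧ :=
  PowerSeries.mk fun n => ∑ p ∈ Finset.HasAntidiagonal.antidiagonal n,
    ∑ q ∈ Finset.HasAntidiagonal.antidiagonal p.2,
    D p.1 (PowerSeries.coeff q.1 u) (PowerSeries.coeff q.2 v)

variable (A) in
/-- A (differential, formal) star product `f ⋆ g = ∑_k λ^k C_k(f, g)` on `A⟦λ⟧`. -/
structure StarProduct where
  C : ℕ → A →ₗ[ℂ] A →ₗ[ℂ] A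
  bidiff : ∀ k, IsBidiffOp (AlgHom.id ℂ A) (AlgHom.id ℂ A) (C k)
  zeroth : ∀ f g, C 0 f g = f * g
  one_star : ∀ f : A⟦X⟧, formalExt C 1 f = f
  star_one : ∀ f : A⟦X⟧, formalExt C f 1 = f
  assoc : ∀ f g h : A⟦X⟧,
    formalExt C (formalExt C f g) h = formalExt C f (formalExt C g h)

namespace StarProduct

variable (S : StarProduct A)

/-- The product `⋆` on `A⟦λ⟧`. -/
def star (f g : A⟦X⟧) : A⟦X⟧ := formalExt S.C f g

/-- The Poisson bracket `{f, g} = (i / 2λ) [f, g]_⋆ |_{λ = 0}`. -/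
def poisson (f g : A) : A := (Complex.I / 2) • (S.C 1 f g - S.C 1 g f)

/-- The differential operator `C_k(a, ·)`. -/
def leftOp (k : ℕ) (a : A) : DiffOp A :=
  ⟨S.C k a, (S.bidiff k).elim fun _ h => h.elim fun l h => ⟨l, h.2 a⟩⟩

/-- The differential operator `C_k(·, a)`. -/
def rightOp (k : ℕ) (a : A) : DiffOp A :=
  ⟨(S.C k).flip a, (S.bidiff k).elim fun k h => h.elim fun _ h => ⟨k, h.1 a⟩⟩

/-- The Hamiltonian vector field `X_a = {a, ·}`, as a differential operator. -/
def ham (a : A) : DiffOp A := (Complex.I / 2) • (S.leftOp 1 a - S.rightOp 1 a)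

theorem ham_apply (a b : A) : (S.ham a : Module.End ℂ A) b = S.poisson a b := by
  simp [ham, leftOp, rightOp, poisson]

end StarProduct

variable (S : StarProduct A) (φ : A →ₐ[ℂ] B)

/-- A left module deformation `a • f = ∑_k λ^k L_k(a, f)` of `B` along `φ : A → B`. -/
structure LeftModuleDeformation where
  L : ℕ → A →ₗ[ℂ] B →ₗ[ℂ] B
  bidiff_L : ∀ k, IsBidiffOp φ (AlgHom.id ℂ B) (L k)
  zeroth_L : ∀ a f, L 0 a f = φ a * f
  one_act : ∀ f : B⟦X⟧, formalExt L 1 f = f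
  star_act : ∀ (a b : A⟦X⟧) (f : B⟦X⟧),
    formalExt L (S.star a b) f = formalExt L a (formalExt L b f)

/-- A right module deformation `f •' a = ∑_k λ^k R_k(f, a)` of `B` along `φ : A → B`. -/
structure RightModuleDeformation where
  R : ℕ → B →ₗ[ℂ] A →ₗ[ℂ] B
  bidiff_R : ∀ k, IsBidiffOp (AlgHom.id ℂ B) φ (R k)
  zeroth_R : ∀ f a, R 0 f a = φ a * f
  act_one : ∀ f : B⟦X⟧, formalExt R f 1 = f
  act_star : ∀ (f : B⟦X⟧) (a b : A⟦X⟧),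
    formalExt R f (S.star a b) = formalExt R (formalExt R f a) b

/-- A bimodule deformation: a left and a right module deformation whose actions commute. -/
structure BimoduleDeformation extends LeftModuleDeformation S φ, RightModuleDeformation S φ where
  act_act : ∀ (a : A⟦X⟧) (f : B⟦X⟧) (b : A⟦X⟧),
    formalExt R (formalExt L a f) b = formalExt L a (formalExt R f b)

/-- A semi-Poisson bracket: a bidifferential operator `(a, f) ↦ ⦃a, f⦄` satisfying the two Leibniz
rules and the Jacobi identity. -/
structure SPBracket where
  br : A →ₗ[ℂ] B →ₗ[ℂ] B
  bidiff : IsBidiffOp φ (AlgHom.id ℂ B) br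
  leibniz_left : ∀ a b f, br (a * b) f = φ a * br b f + φ b * br a f
  leibniz_right : ∀ a b f, br a (φ b * f) = φ (S.poisson a b) * f + φ b * br a f
  jacobi : ∀ a b f, br a (br b f) - br b (br a f) - br (S.poisson a b) f = 0

variable {S φ}

/-- `Φ` lifts differential operators by means of the sP-bracket: it is the identity up to pullback
on functions and sends the Hamiltonian vector field `X_a` to `⦃a, ·⦄`. -/
def SPBracket.IsLift (β : SPBracket S φ) (Φ : DiffOp A →ₐ[ℂ] DiffOp B) : Prop :=
  (∀ a : A, Φ (mulOp a) = mulOp (φ a)) ∧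
  (∀ a : A, (Φ (S.ham a) : Module.End ℂ B) = β.br a)

end Algebraic

/-! ### Manifolds -/

section Manifolds

variable {E M F P : Type*}
  [NormedAddCommGroup E] [NormedSpace ℝ E] [TopologicalSpace M] [ChartedSpace E M]
  [NormedAddCommGroup F] [NormedSpace ℝ F] [TopologicalSpace P] [ChartedSpace F P]

variable (E M) in
/-- The algebra `C^∞(M)` of smooth complex-valued functions, as an algebra of functions. -/
def smoothSubalgebra : Subalgebra ℂ (M → ℂ) where
  carrier := {f | ContMDiff 𝓘(ℝ, E) 𝓘(ℝ, ℂ) ∞ f}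
  mul_mem' := by
    intro f g hf hg
    have h : ContDiff ℝ ∞ (fun p : ℂ × ℂ => p.1 * p.2) := contDiff_mul
    exact h.comp_contMDiff (hf.prodMk_space hg)
  add_mem' := by
    intro f g hf hg
    have h : ContDiff ℝ ∞ (fun p : ℂ × ℂ => p.1 + p.2) := contDiff_add
    exact h.comp_contMDiff (hf.prodMk_space hg)
  algebraMap_mem' := fun c => contMDiff_const (c := c)

variable (E M) in
/-- `C^∞(M)`, the smooth complex-valued functions on a manifold `M` modelled on `E`. -/
abbrev CInf : Type _ := smoothSubalgebra E M

variable (E F) in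
/-- A fibered manifold: a smooth surjective submersion `pr : P → M`. -/
structure IsFibered (pr : P → M) : Prop where
  surjective : Function.Surjective pr
  submersion : Manifold.IsSubmersion 𝓘(ℝ, F) 𝓘(ℝ, E) ∞ pr

theorem IsFibered.smooth [IsManifold 𝓘(ℝ, E) ∞ M] [IsManifold 𝓘(ℝ, F) ∞ P] {pr : P → M}
    (h : IsFibered E F pr) : ContMDiff 𝓘(ℝ, F) 𝓘(ℝ, E) ∞ pr :=
  h.submersion.contMDiff

/-- The pullback `pr^* : C^∞(M) → C^∞(P)`. -/
def IsFibered.pullback [IsManifold 𝓘(ℝ, E) ∞ M] [IsManifold 𝓘(ℝ, F) ∞ P] {pr : P → M}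
    (h : IsFibered E F pr) : CInf E M →ₐ[ℂ] CInf F P where
  toFun a := ⟨fun p => a.1 (pr p), ContMDiff.comp a.2 h.smooth⟩
  map_one' := rfl
  map_mul' _ _ := rfl
  map_zero' := rfl
  map_add' _ _ := rfl
  commutes' _ := rfl

/-- A star product on `M` is symplectic if its Poisson tensor is nondegenerate at every point:
a covector `da_x` with `π_x(da_x, db_x) = {a, b}(x) = 0` for all `b` is zero. -/
def StarProduct.IsSymplectic (S : StarProduct (CInf E M)) : Prop :=
  ∀ (x : M) (a : CInf E M), (∀ b : CInf E M, (S.poisson a b).1 x = 0) →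
    mfderiv 𝓘(ℝ, E) 𝓘(ℝ, ℂ) a.1 x = 0

end Manifolds

end FiberedDeformation

end

/-!
Write `A = C^∞(M)`, `B = C^∞(P)`, `φ = pr^*`. The semi-Poisson bracket `⦃a, ·⦄` plays the role of
covariant differentiation of functions on `P` along the Hamiltonian vector field `{a, ·}`, and its
Jacobi identity says that this connection is flat. Because the Poisson structure is nondegenerate,
Hamiltonian vector fields span all vector fields, so flatness yields, for each `f ∈ B`, each point
`p` and each finite order `m`, a Taylor polynomial: a function `a ∈ A` such that all iterated
Hamiltonian derivatives of `f` at `p` and of `a` at `pr p` agree up to order `m`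
(`SPBracket.exists_mem_agree`). It is built order by order from Euler's formula for homogeneous
functions (`PoissonModule.euler_mem_contact`). The argument is algebraic: it takes place in the
Poisson module `A × B`, filtered by the order of vanishing of `f - pr^* a` at `p`, and uses only a
dual pair of Hamiltonian frames at the point.

A differential operator `D` on `M` then has at most one lift `T` on `P`: its value `(T f)(p)` has to
be `(D a)(pr p)` for an approximation `a` of `f` of sufficiently high order
(`SPBracket.Lifts.unique`). For existence, `D` is near every point a sum of products of functions
and Hamiltonian vector fields (`SPBracket.exists_isWord`); this is again Euler's formula, now
comparing the principal symbol of `D` with those of the commutators `[D, tᵢ]` with coordinates.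
Replacing `{b, ·}` by `⦃b, ·⦄` gives local lifts, which agree on overlaps by uniqueness
(`SPBracket.exists_lifts`). Uniqueness also shows that `D ↦ T` is multiplicative
(`SPBracket.exists_isLift`), and locality of differential operators shows that there
is no other morphism with the prescribed values (`SPBracket.IsLift.unique`).

Finally, the associativity of `⋆` is a family of identities between the operators `C_k(a, ·)` and
`C_k(·, a)`. Applying the morphism to them gives the axioms of a bimodule deformation
(`StarProduct.bimoduleDeformation`).

The manifold enters through Hadamard's lemma (`exists_hadamard`), which provides coordinates
(`exists_coordinates`) and, with the inverse of the Poisson tensor, the Hamiltonian frames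
(`StarProduct.IsSymplectic.exists_inverse`).
-/

noncomputable section

namespace FiberedDeformation

section

/-! ### The Poisson bracket of a star product -/

section Coefficients

variable {U V W X Y Z : Type*} [CommRing U] [Algebra ℂ U] [CommRing V] [Algebra ℂ V]
  [CommRing W] [Algebra ℂ W] [CommRing X] [Algebra ℂ X] [CommRing Y] [Algebra ℂ Y]
  [CommRing Z] [Algebra ℂ Z]

theorem coeff_formalExt (D : ℕ → U →ₗ[ℂ] V →ₗ[ℂ] W) (u : U⟦X⟧) (v : V⟦X⟧) (n : ℕ) :
    PowerSeries.coeff n (formalExt D u v) = ∑ p ∈ Finset.HasAntidiagonal.antidiagonal n,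
      ∑ q ∈ Finset.HasAntidiagonal.antidiagonal p.2,
        D p.1 (PowerSeries.coeff q.1 u) (PowerSeries.coeff q.2 v) := by
  simp [formalExt]

theorem coeff_formalExt_C (D : ℕ → U →ₗ[ℂ] V →ₗ[ℂ] W) (u : U) (v : V⟦X⟧) (n : ℕ) :
    PowerSeries.coeff n (formalExt D (PowerSeries.C u) v) =
      ∑ p ∈ Finset.HasAntidiagonal.antidiagonal n, D p.1 u (PowerSeries.coeff p.2 v) := by
  rw [coeff_formalExt]
  refine Finset.sum_congr rfl fun p _ => ?_
  rw [Finset.sum_eq_single (0, p.2)]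
  · simp
  · rintro ⟨i, j⟩ h hne
    have : i ≠ 0 := by
      rintro rfl
      simp at h; simp [h] at hne
    simp [PowerSeries.coeff_C, this]
  · simp

theorem coeff_formalExt_C_right (D : ℕ → U →ₗ[ℂ] V →ₗ[ℂ] W) (u : U⟦X⟧) (v : V) (n : ℕ) :
    PowerSeries.coeff n (formalExt D u (PowerSeries.C v)) =
      ∑ p ∈ Finset.HasAntidiagonal.antidiagonal n, D p.1 (PowerSeries.coeff p.2 u) v := by
  rw [coeff_formalExt]
  refine Finset.sum_congr rfl fun p _ => ?_
  rw [Finset.sum_eq_single (p.2, 0)]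
  · simp
  · rintro ⟨i, j⟩ h hne
    have : j ≠ 0 := by
      rintro rfl
      simp at h; simp [h] at hne
    simp [PowerSeries.coeff_C, this]
  · simp

theorem coeff_formalExt_C_C (D : ℕ → U →ₗ[ℂ] V →ₗ[ℂ] W) (u : U) (v : V) (n : ℕ) :
    PowerSeries.coeff n (formalExt D (PowerSeries.C u) (PowerSeries.C v)) = D n u v := by
  rw [coeff_formalExt_C, Finset.sum_eq_single (n, 0)]
  · simp
  · rintro ⟨i, j⟩ h hne
    have : j ≠ 0 := by
      rintro rfl
      simp at h; simp [h] at hne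
    simp [PowerSeries.coeff_C, this]
  · simp

open Finset in
/-- An associativity law for formal operations may be checked on coefficients: reordering a
fourfold Cauchy product. -/
theorem formalExt_assoc_of_coeff (D₁ : ℕ → X →ₗ[ℂ] W →ₗ[ℂ] Z) (D₂ : ℕ → U →ₗ[ℂ] V →ₗ[ℂ] X)
    (D₃ : ℕ → U →ₗ[ℂ] Y →ₗ[ℂ] Z) (D₄ : ℕ → V →ₗ[ℂ] W →ₗ[ℂ] Y)
    (h : ∀ n u v w, ∑ p ∈ antidiagonal n, D₁ p.1 (D₂ p.2 u v) w =
      ∑ p ∈ antidiagonal n, D₃ p.1 u (D₄ p.2 v w)) (u : U⟦X⟧) (v : V⟦X⟧) (w : W⟦X⟧) :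
    formalExt D₁ (formalExt D₂ u v) w = formalExt D₃ u (formalExt D₄ v w) := by
  ext n
  simp only [coeff_formalExt, map_sum, LinearMap.sum_apply]
  -- collect the indices of `u`, `v`, `w` first, and those of the operations last
  trans ∑ p ∈ antidiagonal n, ∑ q ∈ antidiagonal p.2, ∑ r ∈ antidiagonal q.2,
    ∑ s ∈ antidiagonal p.1, D₁ s.1 (D₂ s.2 (PowerSeries.coeff q.1 u) (PowerSeries.coeff r.1 v))
      (PowerSeries.coeff r.2 w)
  · simp only [Finset.sum_sigma']
    refine Finset.sum_nbij'
      (fun ⟨p, q, r, s⟩ => ⟨(p.1 + r.1, s.1 + s.2 + q.2), (s.1, s.2 + q.2), (s.2, q.2), p.1, r.1⟩)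
      (fun ⟨_, q, r, s⟩ => ⟨(s.1, s.2 + q.1 + r.1 + r.2), (s.2 + q.1 + r.1, r.2),
        (s.2, q.1 + r.1), q.1, r.1⟩) ?_ ?_ ?_ ?_ ?_
    pick_goal 5
    · rintro ⟨p, q, r, s⟩ _
      rfl
    all_goals
      rintro ⟨⟨a, b⟩, ⟨c, d⟩, ⟨e, f⟩, ⟨g, h⟩⟩ hx
      simp only [mem_sigma, HasAntidiagonal.mem_antidiagonal] at hx ⊢
      obtain ⟨h1, h2, h3, h4⟩ := hx
      subst h4 h3 h2
      first | omega | (subst h1; simp [add_assoc])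
  trans ∑ p ∈ antidiagonal n, ∑ q ∈ antidiagonal p.2, ∑ r ∈ antidiagonal q.2,
    ∑ s ∈ antidiagonal p.1, D₃ s.1 (PowerSeries.coeff q.1 u)
      (D₄ s.2 (PowerSeries.coeff r.1 v) (PowerSeries.coeff r.2 w))
  · simp only [h]
  · simp only [Finset.sum_sigma']
    refine Finset.sum_nbij'
      (fun ⟨_, q, r, s⟩ => ⟨(s.1, q.1 + (s.2 + r.1 + r.2)), (q.1, s.2 + r.1 + r.2),
        (s.2, r.1 + r.2), r.1, r.2⟩)
      (fun ⟨p, q, r, s⟩ => ⟨(p.1 + r.1, q.1 + s.1 + s.2), (q.1, s.1 + s.2), (s.1, s.2),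
        p.1, r.1⟩) ?_ ?_ ?_ ?_ ?_
    pick_goal 5
    · rintro ⟨p, q, r, s⟩ _
      rfl
    all_goals
      rintro ⟨⟨a, b⟩, ⟨c, d⟩, ⟨e, f⟩, ⟨g, h⟩⟩ hx
      simp only [mem_sigma, HasAntidiagonal.mem_antidiagonal] at hx ⊢
      obtain ⟨h1, h2, h3, h4⟩ := hx
      subst h4 h3 h2
      first | omega | (subst h1; simp [add_assoc]; try omega)

end Coefficients

variable {A : Type*} [CommRing A] [Algebra ℂ A]

namespace StarProduct

variable (S : StarProduct A)

theorem sum_assoc (n : ℕ) (a b c : A) :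
    ∑ p ∈ Finset.HasAntidiagonal.antidiagonal n, S.C p.1 (S.C p.2 a b) c =
      ∑ p ∈ Finset.HasAntidiagonal.antidiagonal n, S.C p.1 a (S.C p.2 b c) := by
  have h := congrArg (PowerSeries.coeff n)
    (S.assoc (PowerSeries.C a) (PowerSeries.C b) (PowerSeries.C c))
  rw [coeff_formalExt_C_right, coeff_formalExt_C] at h
  simpa only [coeff_formalExt_C_C] using h

theorem C_one_left (k : ℕ) (a : A) : S.C k 1 a = if k = 0 then a else 0 := by
  have h := congrArg (PowerSeries.coeff k) (S.one_star (PowerSeries.C a))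
  rw [← map_one PowerSeries.C, coeff_formalExt_C_C, PowerSeries.coeff_C] at h
  exact h

theorem C_one_right (k : ℕ) (a : A) : S.C k a 1 = if k = 0 then a else 0 := by
  have h := congrArg (PowerSeries.coeff k) (S.star_one (PowerSeries.C a))
  rw [← map_one PowerSeries.C, coeff_formalExt_C_C, PowerSeries.coeff_C] at h
  exact h

/-- Associativity in degree 1: `C₁` is a Hochschild cocycle. -/
theorem assoc_one (a b c : A) :
    S.C 1 (a * b) c + S.C 1 a b * c = S.C 1 a (b * c) + a * S.C 1 b c := by
  have h := S.sum_assoc 1 a b c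
  simp only [Finset.Nat.antidiagonal_succ, Finset.Nat.antidiagonal_zero] at h
  simp [S.zeroth] at h
  linear_combination h

/-- Associativity in degree 2: the associator of `C₁` is the Hochschild coboundary of `C₂`. -/
theorem assoc_two (a b c : A) :
    S.C 2 (a * b) c + S.C 1 (S.C 1 a b) c + S.C 2 a b * c =
      S.C 2 a (b * c) + S.C 1 a (S.C 1 b c) + a * S.C 2 b c := by
  have h := S.sum_assoc 2 a b c
  simp only [Finset.Nat.antidiagonal_succ, Finset.Nat.antidiagonal_zero] at h
  simp [S.zeroth] at h
  linear_combination h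

theorem poisson_antisymm (a b : A) : S.poisson a b = -S.poisson b a := by
  rw [poisson, poisson, ← smul_neg, neg_sub]

/-- The Leibniz rule: antisymmetrize the cocycle identity for `C₁`. -/
theorem poisson_mul (a b c : A) :
    S.poisson a (b * c) = S.poisson a b * c + b * S.poisson a c := by
  have h : S.C 1 a (b * c) - S.C 1 (b * c) a =
      (S.C 1 a b - S.C 1 b a) * c + b * (S.C 1 a c - S.C 1 c a) := by
    have h1 := S.assoc_one a b c
    have h2 := S.assoc_one b c a
    have h3 := S.assoc_one b a c
    rw [mul_comm c a] at h2
    rw [mul_comm b a] at h3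
    linear_combination -h1 - h2 + h3
  simp only [poisson, h, smul_add, smul_mul_assoc, mul_smul_comm]

theorem mul_poisson (a b c : A) :
    S.poisson (a * b) c = a * S.poisson b c + b * S.poisson a c := by
  rw [poisson_antisymm, poisson_mul, S.poisson_antisymm b, S.poisson_antisymm a]
  ring

/-- The Jacobi identity: in the alternating sum of the associativity relations in degree 2, the
terms with `C₂` cancel. -/
theorem poisson_jacobi (a b c : A) :
    S.poisson a (S.poisson b c) = S.poisson b (S.poisson a c) + S.poisson (S.poisson a b) c := by
  have h : (S.C 1 a (S.C 1 b c - S.C 1 c b) - S.C 1 (S.C 1 b c - S.C 1 c b) a) =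
      (S.C 1 b (S.C 1 a c - S.C 1 c a) - S.C 1 (S.C 1 a c - S.C 1 c a) b) +
      (S.C 1 (S.C 1 a b - S.C 1 b a) c - S.C 1 c (S.C 1 a b - S.C 1 b a)) := by
    have h1 := S.assoc_two a b c
    have h2 := S.assoc_two b c a
    have h3 := S.assoc_two c a b
    have h4 := S.assoc_two a c b
    have h5 := S.assoc_two b a c
    have h6 := S.assoc_two c b a
    rw [mul_comm c a] at h2 h3
    rw [mul_comm c b] at h4 h6
    rw [mul_comm b a] at h5 h6
    simp only [map_sub, LinearMap.sub_apply]
    linear_combination -h1 - h2 - h3 + h4 + h5 + h6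
  simp only [poisson, map_smul, LinearMap.smul_apply, ← smul_sub, h, smul_add]

/-- The Poisson bracket as a bilinear map. -/
def poissonₗ : A →ₗ[ℂ] A →ₗ[ℂ] A := (Complex.I / 2) • (S.C 1 - (S.C 1).flip)

@[simp]
theorem poissonₗ_apply (a b : A) : S.poissonₗ a b = S.poisson a b := by
  simp [poissonₗ, poisson]

end StarProduct

end

section

variable {A B : Type*} [CommRing A] [Algebra ℂ A] [CommRing B] [Algebra ℂ B]

/-! ### Poisson modules and the order of contact at a point -/

/-- A module over the Poisson algebra `A`: functions act by `mul`, and `ham` is the action of their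
Hamiltonian vector fields. -/
structure PoissonModule (S : StarProduct A) (N : Type*) [AddCommGroup N] [Module ℂ N] where
  mul : A →ₐ[ℂ] Module.End ℂ N
  ham : A →ₗ[ℂ] Module.End ℂ N
  ham_mul : ∀ a b, ham (a * b) = mul a * ham b + mul b * ham a
  ham_comp_mul : ∀ a b, ham a * mul b = mul (S.poisson a b) + mul b * ham a
  ham_comp_ham : ∀ a b, ham a * ham b = ham b * ham a + ham (S.poisson a b)

/-- The algebra `A` as a Poisson module over itself. -/
def StarProduct.selfModule (S : StarProduct A) : PoissonModule S A where
  mul := Algebra.lmul ℂ A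
  ham := S.poissonₗ
  ham_mul a b := by
    ext c; simp [S.mul_poisson]
  ham_comp_mul a b := by
    ext c; simp [S.poisson_mul]
  ham_comp_ham a b := by
    ext c; simp [S.poisson_jacobi a b c]

/-- A semi-Poisson bracket makes `B` a Poisson module. -/
def SPBracket.poissonModule {S : StarProduct A} {φ : A →ₐ[ℂ] B} (β : SPBracket S φ) :
    PoissonModule S B where
  mul := (Algebra.lmul ℂ B).comp φ
  ham := β.br
  ham_mul a b := by
    ext f; simp [β.leibniz_left]
  ham_comp_mul a b := by
    ext f; simp [β.leibniz_right]
  ham_comp_ham a b := by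
    ext f
    have h := β.jacobi a b f
    simp only [Module.End.mul_apply, LinearMap.add_apply]
    linear_combination h

namespace PoissonModule

variable {S : StarProduct A} {N N' : Type*} [AddCommGroup N] [Module ℂ N]
  [AddCommGroup N'] [Module ℂ N']

/-- The direct sum of two Poisson modules. -/
def prod (V : PoissonModule S N) (V' : PoissonModule S N') : PoissonModule S (N × N') where
  mul := (LinearMap.prodMapAlgHom ℂ N N').comp (V.mul.prod V'.mul)
  ham :=
    { toFun a := (V.ham a).prodMap (V'.ham a)
      map_add' a b := by ext <;> simp
      map_smul' c a := by ext <;> simp }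
  ham_mul a b := LinearMap.ext fun n => Prod.ext
    (LinearMap.congr_fun (V.ham_mul a b) n.1) (LinearMap.congr_fun (V'.ham_mul a b) n.2)
  ham_comp_mul a b := LinearMap.ext fun n => Prod.ext
    (LinearMap.congr_fun (V.ham_comp_mul a b) n.1) (LinearMap.congr_fun (V'.ham_comp_mul a b) n.2)
  ham_comp_ham a b := LinearMap.ext fun n => Prod.ext
    (LinearMap.congr_fun (V.ham_comp_ham a b) n.1) (LinearMap.congr_fun (V'.ham_comp_ham a b) n.2)

@[simp]
theorem prod_mul_apply (V : PoissonModule S N) (V' : PoissonModule S N') (a : A) (n : N × N') :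
    (V.prod V').mul a n = (V.mul a n.1, V'.mul a n.2) := rfl

@[simp]
theorem prod_ham_apply (V : PoissonModule S N) (V' : PoissonModule S N') (a : A) (n : N × N') :
    (V.prod V').ham a n = (V.ham a n.1, V'.ham a n.2) := rfl

variable (V : PoissonModule S N)

theorem ham_mul_apply (a b : A) (n : N) :
    V.ham (a * b) n = V.mul a (V.ham b n) + V.mul b (V.ham a n) :=
  LinearMap.congr_fun (V.ham_mul a b) n

theorem ham_mul_act (a b : A) (n : N) :
    V.ham a (V.mul b n) = V.mul (S.poisson a b) n + V.mul b (V.ham a n) :=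
  LinearMap.congr_fun (V.ham_comp_mul a b) n

theorem ham_ham (a b : A) (n : N) :
    V.ham a (V.ham b n) = V.ham b (V.ham a n) + V.ham (S.poisson a b) n :=
  LinearMap.congr_fun (V.ham_comp_ham a b) n

theorem ham_one : V.ham 1 = 0 := by
  have h := V.ham_mul 1 1
  simpa using h

theorem ham_algebraMap (c : ℂ) : V.ham (algebraMap ℂ A c) = 0 := by
  rw [Algebra.algebraMap_eq_smul_one, map_smul, ham_one, smul_zero]

/-- `V.contact ev m` consists of the elements `n` for which `ev` vanishes on `n` and on everything
obtained from `n` by applying fewer than `m` Hamiltonian vector fields: "`n` vanishes to order `m`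
at the point where `ev` evaluates". -/
def contact (ev : N →ₗ[ℂ] ℂ) : ℕ → Submodule ℂ N
  | 0 => ⊤
  | m + 1 => LinearMap.ker ev ⊓ ⨅ b, (contact ev m).comap (V.ham b)

variable {V} {ev : N →ₗ[ℂ] ℂ}

theorem mem_contact_succ {m : ℕ} {n : N} :
    n ∈ V.contact ev (m + 1) ↔ ev n = 0 ∧ ∀ b, V.ham b n ∈ V.contact ev m := by
  simp [contact]

theorem contact_succ_le (m : ℕ) : V.contact ev (m + 1) ≤ V.contact ev m := by
  induction m with
  | zero => exact le_top
  | succ m ih =>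
    intro n hn
    rw [mem_contact_succ] at hn ⊢
    exact ⟨hn.1, fun b => ih (hn.2 b)⟩

theorem contact_antitone : Antitone (V.contact ev) := antitone_nat_of_succ_le contact_succ_le

variable {χ : A →ₐ[ℂ] ℂ} (hev : ∀ a n, ev (V.mul a n) = χ a * ev n)

include hev

theorem mul_mem_contact {m : ℕ} (a : A) {n : N} (hn : n ∈ V.contact ev m) :
    V.mul a n ∈ V.contact ev m := by
  induction m generalizing a n with
  | zero => trivial
  | succ m ih =>
    rw [mem_contact_succ]
    refine ⟨by rw [hev, (mem_contact_succ.1 hn).1, mul_zero], fun b => ?_⟩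
    rw [ham_mul_act]
    exact add_mem (ih _ (contact_succ_le m hn)) (ih _ ((mem_contact_succ.1 hn).2 b))

theorem mul_mem_contact_succ {m : ℕ} {a : A} (ha : χ a = 0) {n : N} (hn : n ∈ V.contact ev m) :
    V.mul a n ∈ V.contact ev (m + 1) := by
  induction m generalizing n with
  | zero =>
    exact mem_contact_succ.2 ⟨by rw [hev, ha, zero_mul], fun _ => trivial⟩
  | succ m ih =>
    rw [mem_contact_succ]
    refine ⟨by rw [hev, ha, zero_mul], fun b => ?_⟩
    rw [ham_mul_act]
    exact add_mem (mul_mem_contact hev _ hn) (ih ((mem_contact_succ.1 hn).2 b))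

theorem pow_mul_mem_contact {a : A} (ha : χ a = 0) (m : ℕ) (n : N) :
    V.mul (a ^ m) n ∈ V.contact ev m := by
  induction m with
  | zero => trivial
  | succ m ih =>
    rw [pow_succ', map_mul]
    exact mul_mem_contact_succ hev ha ih

/-- `contact` is local: an element killed by a function that takes the value `1` at the point
vanishes to every order there. -/
theorem mem_contact_of_mul_eq_zero {a : A} (ha : χ a = 1) {n : N} (hn : V.mul a n = 0) (m : ℕ) :
    n ∈ V.contact ev m := by
  have h : V.mul ((1 - a) ^ m) n = n := by
    induction m with
    | zero => simp
    | succ m ih =>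
      rw [pow_succ, map_mul, Module.End.mul_apply, map_sub, LinearMap.sub_apply, hn, map_one,
        sub_zero, Module.End.one_apply, ih]
  rw [← h]
  exact pow_mul_mem_contact hev (by simp [ha]) m n

/-- Up to elements of the same order of vanishing as `n`, the derivative of `n` along the
Hamiltonian vector field of `c` depends only on the differential of `c` at the point. -/
theorem ham_mem_contact_of_mem_sq {c : A} (hc : c ∈ RingHom.ker χ ^ 2) {m : ℕ} {n : N}
    (hn : n ∈ V.contact ev (m + 1)) : V.ham c n ∈ V.contact ev (m + 1) := by
  rw [pow_two] at hc
  induction hc using Submodule.mul_induction_on' with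
  | mem_mul_mem a ha b hb =>
    rw [ham_mul_apply]
    exact add_mem (mul_mem_contact_succ hev ha ((mem_contact_succ.1 hn).2 b))
      (mul_mem_contact_succ hev hb ((mem_contact_succ.1 hn).2 a))
  | add a _ b _ iha ihb =>
    rw [map_add]
    exact add_mem iha ihb

-- `hz` says that `db = ∑ {b, yᵢ}(x) dzᵢ` for every `b`, at the point `x` where `χ` evaluates
variable {ι : Type*} [Fintype ι] {y z : ι → A} (hy : ∀ i, χ (y i) = 0)
  (hz : ∀ b, b - algebraMap ℂ A (χ b) - ∑ i, χ (S.poisson b (y i)) • z i ∈ RingHom.ker χ ^ 2)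

include hy hz

/-- Euler's formula for homogeneous functions: on elements vanishing to order `m`, the Euler vector
field `∑ yᵢ X_{zᵢ}` is multiplication by `m`, up to elements vanishing to order `m + 1`. -/
theorem euler_mem_contact {m : ℕ} {n : N} (hn : n ∈ V.contact ev m) :
    (m : ℂ) • n - ∑ i, V.mul (y i) (V.ham (z i) n) ∈ V.contact ev (m + 1) := by
  induction m generalizing n with
  | zero =>
    rw [Nat.cast_zero, zero_smul, zero_sub]
    exact neg_mem (sum_mem fun i _ => mul_mem_contact_succ hev (hy i) trivial)
  | succ m ih =>
    have hn' := mem_contact_succ.1 hn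
    rw [mem_contact_succ]
    refine ⟨by simp [hn'.1, hev, hy], fun b => ?_⟩
    -- `b` agrees to first order with the combination of the `zᵢ` with coefficients `{b, yᵢ}(x)`
    have h1 : V.ham b n - ∑ i, V.mul (S.poisson b (y i)) (V.ham (z i) n)
        ∈ V.contact ev (m + 1) := by
      have h2 := ham_mem_contact_of_mem_sq hev (hz b) hn
      have h3 : ∑ i, V.mul (S.poisson b (y i) - algebraMap ℂ A (χ (S.poisson b (y i))))
          (V.ham (z i) n) ∈ V.contact ev (m + 1) :=
        sum_mem fun i _ => mul_mem_contact_succ hev (by simp) (hn'.2 _)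
      convert sub_mem h2 h3 using 1
      simp only [map_sub, map_sum, map_smul, LinearMap.sub_apply, LinearMap.sum_apply,
        LinearMap.smul_apply, ham_algebraMap, AlgHom.commutes, Module.algebraMap_end_apply,
        Finset.sum_sub_distrib, LinearMap.zero_apply]
      abel
    have h4 : ∑ i, V.mul (y i) (V.ham (S.poisson b (z i)) n) ∈ V.contact ev (m + 1) :=
      sum_mem fun i _ => mul_mem_contact_succ hev (hy i) (hn'.2 _)
    have h5 := sub_mem (add_mem (ih (hn'.2 b)) h1) h4
    convert h5 using 1
    simp only [map_sub, map_sum, map_smul, ham_mul_act, ham_ham V b, map_add,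
      Finset.sum_add_distrib, Nat.cast_add, Nat.cast_one, add_smul, one_smul]
    abel

/-- Given an `A`-linear map `j` from `A` to the Poisson module `V`, every element of `V` can be
approximated to any order by elements of `A`: these are the Taylor polynomials of the flat
connection. The next homogeneous part is found by approximating the first derivatives of the
remainder and applying Euler's formula. -/
theorem exists_sub_mem_contact (j : A →ₗ[ℂ] N) (hj_mul : ∀ a b, j (a * b) = V.mul a (j b))
    (hj_one : ev (j 1) = 1) (m : ℕ) (n : N) : ∃ a, n - j a ∈ V.contact ev m := by
  induction m generalizing n with
  | zero => exact ⟨0, trivial⟩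
  | succ m ih =>
    obtain ⟨a₀, h₀⟩ := ih n
    rcases m with _ | m
    · refine ⟨algebraMap ℂ A (ev n), mem_contact_succ.2 ⟨?_, fun _ => trivial⟩⟩
      rw [Algebra.algebraMap_eq_smul_one, map_smul, map_sub, map_smul, hj_one]
      simp
    choose a ha using fun i => ih (V.ham (z i) (n - j a₀))
    have h1 := euler_mem_contact hev hy hz h₀
    have h2 : ∑ i, V.mul (y i) (V.ham (z i) (n - j a₀) - j (a i)) ∈ V.contact ev (m + 2) :=
      sum_mem fun i _ => mul_mem_contact_succ hev (hy i) (ha i)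
    have hm : ((m + 1 : ℕ) : ℂ) ≠ 0 := Nat.cast_ne_zero.2 m.succ_ne_zero
    refine ⟨a₀ + ((m + 1 : ℕ) : ℂ)⁻¹ • ∑ i, y i * a i, ?_⟩
    convert Submodule.smul_mem _ ((m + 1 : ℕ) : ℂ)⁻¹ (add_mem h1 h2) using 1
    simp only [map_sub, Finset.sum_sub_distrib, map_add, map_smul, map_sum, hj_mul]
    rw [sub_add_sub_cancel, smul_sub, smul_smul, inv_mul_cancel₀ hm, one_smul]
    abel

end PoissonModule

end

section

variable {A B : Type*} [CommRing A] [Algebra ℂ A] [CommRing B] [Algebra ℂ B]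

/-! ### Differential operators as words in Hamiltonian vector fields -/

theorem IsDiffOp.smul {φ : A →ₐ[ℂ] B} {k : ℕ} (b : B) {D : A →ₗ[ℂ] B} (h : IsDiffOp φ k D) :
    IsDiffOp φ k (LinearMap.mulLeft ℂ b ∘ₗ D) := by
  induction k generalizing D with
  | zero =>
    intro a c
    have h1 : ∀ a c : A, D (a * c) = φ a * D c := h
    simp only [LinearMap.comp_apply, LinearMap.mulLeft_apply, h1]
    ring
  | succ k ih =>
    intro a
    have e : comm φ (LinearMap.mulLeft ℂ b ∘ₗ D) a = LinearMap.mulLeft ℂ b ∘ₗ comm φ D a := by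
      ext c
      simp only [comm, LinearMap.sub_apply, LinearMap.comp_apply, LinearMap.mulLeft_apply]
      ring
    rw [e]
    exact ih (h a)

theorem IsDiffOp.const_smul {φ : A →ₐ[ℂ] B} {k : ℕ} (c : ℂ) {D : A →ₗ[ℂ] B}
    (h : IsDiffOp φ k D) : IsDiffOp φ k (c • D) := by
  convert h.smul (algebraMap ℂ B c) using 1
  ext a
  simp [Algebra.algebraMap_eq_smul_one]

/-- A differential operator of order `k` does not see functions vanishing to order `k + 1`. -/
theorem IsDiffOp.apply_eq_zero (χ : A →ₐ[ℂ] ℂ) {k : ℕ} {D : A →ₗ[ℂ] A}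
    (h : IsDiffOp (AlgHom.id ℂ A) k D) {a : A} (ha : a ∈ RingHom.ker χ ^ (k + 1)) :
    χ (D a) = 0 := by
  induction k generalizing D a with
  | zero =>
    have h1 : ∀ a b : A, D (a * b) = a * D b := h
    have ha' : χ a = 0 := by simpa using ha
    rw [← mul_one a, h1, map_mul, ha', zero_mul]
  | succ k ih =>
    rw [pow_succ'] at ha
    induction ha using Submodule.mul_induction_on' with
    | mem_mul_mem u hu v hv =>
      have h1 : D (u * v) = comm (AlgHom.id ℂ A) D u v + u * D v := by simp [comm]
      have hu' : χ u = 0 := hu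
      rw [h1, map_add, map_mul, ih (h u) hv, hu', zero_mul, add_zero]
    | add u _ v _ hu hv => rw [map_add, map_add, hu, hv, add_zero]

variable {S : StarProduct A}

section LocalGeneration

variable {ι : Type*} [Fintype ι] {t h s : ι → A} {χ : A →ₐ[ℂ] ℂ}
  -- `db = ∑ hᵢ {sᵢ, b} dtᵢ` at the point where `χ` evaluates
  (hχ : ∀ b, b - algebraMap ℂ A (χ b) -
    ∑ i, (χ (h i) * χ (S.poisson (s i) b)) • (t i - algebraMap ℂ A (χ (t i))) ∈
      RingHom.ker χ ^ 2)

include hχ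

/-- The Euler vector field `∑ (tᵢ - tᵢ(x)) hᵢ X_{sᵢ}` is multiplication by `k` on `I^k / I^(k+1)`,
where `I` is the ideal of functions vanishing at `x`. -/
theorem euler_mem_ker_pow {k : ℕ} {a : A} (ha : a ∈ RingHom.ker χ ^ k) :
    (k : ℂ) • a - ∑ i, (t i - algebraMap ℂ A (χ (t i))) * (h i * S.poisson (s i) a) ∈
      RingHom.ker χ ^ (k + 1) := by
  induction k generalizing a with
  | zero =>
    rw [Nat.cast_zero, zero_smul, zero_sub, zero_add, pow_one]
    exact neg_mem (sum_mem fun i _ => Ideal.mul_mem_right _ _ (by simp [RingHom.mem_ker]))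
  | succ k ih =>
    rw [pow_succ] at ha
    induction ha using Submodule.mul_induction_on' with
    | mem_mul_mem u hu v hv =>
      have hv' : χ v = 0 := hv
      have h1 : v - ∑ i, (t i - algebraMap ℂ A (χ (t i))) * (h i * S.poisson (s i) v) ∈
          RingHom.ker χ ^ 2 := by
        have h2 : ∑ i, (t i - algebraMap ℂ A (χ (t i))) *
            (h i * S.poisson (s i) v - algebraMap ℂ A (χ (h i) * χ (S.poisson (s i) v))) ∈
              RingHom.ker χ ^ 2 := by
          rw [pow_two]
          exact sum_mem fun i _ => Ideal.mul_mem_mul (by simp [RingHom.mem_ker])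
            (by simp [RingHom.mem_ker])
        convert sub_mem (hχ v) h2 using 1
        rw [hv', map_zero, sub_zero, sub_sub, ← Finset.sum_add_distrib]
        refine congrArg _ (Finset.sum_congr rfl fun i _ => ?_)
        rw [Algebra.smul_def]
        ring
      have h3 := Ideal.mul_mem_mul (ih hu) hv
      have h4 := Ideal.mul_mem_mul hu h1
      rw [← pow_succ] at h3
      rw [← pow_add] at h4
      convert add_mem h3 h4 using 1
      simp only [S.poisson_mul, sub_mul, mul_sub, Finset.sum_mul, Finset.mul_sum, Nat.cast_add,
        Nat.cast_one, add_smul, one_smul, smul_mul_assoc, mul_add, Finset.sum_add_distrib,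
        Finset.sum_sub_distrib]
      have e : ∀ i, u * (t i * (h i * S.poisson (s i) v)) = t i * (h i * (u * S.poisson (s i) v)) :=
        fun i => by ring
      have e' : ∀ i, u * (algebraMap ℂ A (χ (t i)) * (h i * S.poisson (s i) v)) =
        algebraMap ℂ A (χ (t i)) * (h i * (u * S.poisson (s i) v)) := fun i => by ring
      simp only [e, e', mul_assoc]
      abel
    | add u _ v _ hu hv =>
      convert add_mem hu hv using 1
      simp only [← S.poissonₗ_apply, map_add, mul_add, Finset.sum_add_distrib, smul_add]
      abel

end LocalGeneration

namespace SPBracket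

variable {φ : A →ₐ[ℂ] B} (β : SPBracket S φ)

/-- `β.IsWord k D T`: the operator `D` on `A` is a sum of products of at most `k` Hamiltonian vector
fields with a function in front, and `T` is the operator on `B` obtained by replacing each
Hamiltonian vector field `{b, ·}` by `⦃b, ·⦄`. -/
inductive IsWord : ℕ → Module.End ℂ A → Module.End ℂ B → Prop
  | mul (a : A) : IsWord 0 (LinearMap.mulLeft ℂ a) (LinearMap.mulLeft ℂ (φ a))
  | mul_ham {k : ℕ} {D : Module.End ℂ A} {T : Module.End ℂ B} (b : A) (w : IsWord k D T) :
      IsWord (k + 1) (D * S.poissonₗ b) (T * β.br b)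
  | add {k : ℕ} {D D' : Module.End ℂ A} {T T' : Module.End ℂ B} (w : IsWord k D T)
      (w' : IsWord k D' T') : IsWord k (D + D') (T + T')
  | smul {k : ℕ} {D : Module.End ℂ A} {T : Module.End ℂ B} (c : ℂ) (w : IsWord k D T) :
      IsWord k (c • D) (c • T)
  | succ {k : ℕ} {D : Module.End ℂ A} {T : Module.End ℂ B} (w : IsWord k D T) :
      IsWord (k + 1) D T

variable {β}

theorem IsWord.zero (k : ℕ) : β.IsWord k 0 0 := by
  induction k with
  | zero => simpa using IsWord.mul (β := β) 0
  | succ k ih => exact ih.succ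

theorem IsWord.sum {ι : Type*} (I : Finset ι) {k : ℕ} {D : ι → Module.End ℂ A}
    {T : ι → Module.End ℂ B} (w : ∀ i, β.IsWord k (D i) (T i)) :
    β.IsWord k (∑ i ∈ I, D i) (∑ i ∈ I, T i) := by
  classical
  induction I using Finset.induction_on with
  | empty => simpa using IsWord.zero k
  | insert i I hi ih =>
    rw [Finset.sum_insert hi, Finset.sum_insert hi]
    exact (w i).add ih

theorem IsWord.isDiffOp {l : ℕ} (hl : ∀ b, IsDiffOp (AlgHom.id ℂ B) l (β.br b)) {k : ℕ}
    {D : Module.End ℂ A} {T : Module.End ℂ B} (w : β.IsWord k D T) :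
    IsDiffOp (AlgHom.id ℂ B) (k * l) T := by
  induction w with
  | mul a => exact (isDiffOp_mulLeft _).mono (Nat.zero_le _)
  | mul_ham b _ ih => exact IsDiffOp.comp (by ring) ih (hl b)
  | add _ _ ih ih' => exact ih.add ih'
  | smul c _ ih => exact ih.const_smul c
  | succ _ ih => exact ih.mono (by nlinarith)

theorem coe_ham (b : A) : (S.ham b : Module.End ℂ A) = S.poissonₗ b :=
  LinearMap.ext fun a => by rw [S.ham_apply, S.poissonₗ_apply]

/-- Every lift of differential operators has the expected value on words. -/
theorem IsWord.exists_isLift_apply {k : ℕ} {D : Module.End ℂ A} {T : Module.End ℂ B}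
    (w : β.IsWord k D T) :
    ∃ hD : D ∈ DiffOp A, ∀ Ψ, β.IsLift Ψ → (Ψ ⟨D, hD⟩ : Module.End ℂ B) = T := by
  induction w with
  | mul a => exact ⟨(mulOp a).2, fun Ψ hΨ => congrArg Subtype.val (hΨ.1 a)⟩
  | mul_ham b _ ih =>
    obtain ⟨hD, h⟩ := ih
    have e := coe_ham (S := S) b
    refine ⟨mul_mem hD (e ▸ (S.ham b).2), fun Ψ hΨ => ?_⟩
    have h1 := hΨ.2 b
    rw [← h Ψ hΨ, ← h1, ← MulMemClass.coe_mul, ← map_mul]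
    congr 2
  | add _ _ ih ih' =>
    obtain ⟨hD, h⟩ := ih
    obtain ⟨hD', h'⟩ := ih'
    refine ⟨add_mem hD hD', fun Ψ hΨ => ?_⟩
    rw [← h Ψ hΨ, ← h' Ψ hΨ, ← AddMemClass.coe_add, ← map_add]
    rfl
  | smul c _ ih =>
    obtain ⟨hD, h⟩ := ih
    refine ⟨Subalgebra.smul_mem _ hD c, fun Ψ hΨ => ?_⟩
    rw [← h Ψ hΨ, ← Subalgebra.coe_smul, ← map_smul]
    rfl
  | succ _ ih => exact ih

/-- Near a point with a Hamiltonian frame, every differential operator of order `k` is a word of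
length `k`. The neighbourhood is encoded as a set `U` of characters, and the frame as functions
`tᵢ`, `hᵢ`, `sᵢ` such that `db = ∑ hᵢ {sᵢ, b} dtᵢ` at every point of `U`. -/
theorem exists_isWord {ι : Type*} [Fintype ι] {t h s : ι → A} {U : Set (A →ₐ[ℂ] ℂ)}
    (hU : ∀ χ ∈ U, ∀ b, b - algebraMap ℂ A (χ b) -
      ∑ i, (χ (h i) * χ (S.poisson (s i) b)) • (t i - algebraMap ℂ A (χ (t i))) ∈
        RingHom.ker χ ^ 2)
    {k : ℕ} {D : Module.End ℂ A} (hD : ∀ χ ∈ U, ∀ a ∈ RingHom.ker χ ^ (k + 1), χ (D a) = 0) :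
    ∃ D' T', β.IsWord k D' T' ∧ ∀ χ ∈ U, ∀ a, χ (D a) = χ (D' a) := by
  induction k generalizing D with
  | zero =>
    refine ⟨_, _, IsWord.mul (D 1), fun χ hχ a => ?_⟩
    have h1 := hD χ hχ (a - algebraMap ℂ A (χ a)) (by simp [RingHom.mem_ker])
    rw [map_sub, map_sub, sub_eq_zero, Algebra.algebraMap_eq_smul_one, map_smul, map_smul] at h1
    rw [h1, LinearMap.mulLeft_apply, map_mul, smul_eq_mul, mul_comm]
  | succ k ih =>
    let d : ι → Module.End ℂ A := fun i =>
      (D * LinearMap.mulLeft ℂ (t i) - LinearMap.mulLeft ℂ (t i) * D) * LinearMap.mulLeft ℂ (h i)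
    have hd : ∀ (χ : A →ₐ[ℂ] ℂ) i a,
        χ (d i a) = χ (D ((t i - algebraMap ℂ A (χ (t i))) * (h i * a))) := by
      intro χ i a
      simp [d, sub_mul, ← Algebra.smul_def]
    have h1 : ∀ i, ∃ D' T', β.IsWord k D' T' ∧ ∀ χ ∈ U, ∀ a, χ (d i a) = χ (D' a) := by
      refine fun i => ih fun χ hχ a ha => ?_
      rw [hd]
      apply hD χ hχ
      rw [pow_succ']
      exact Ideal.mul_mem_mul (by simp [RingHom.mem_ker]) (Ideal.mul_mem_left _ _ ha)
    choose D₁ T₁ w₁ hw₁ using h1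
    -- by Euler's formula, the principal symbols of `∑ᵢ [D, tᵢ] hᵢ X_{sᵢ}` and `(k + 1) D` agree
    obtain ⟨D₂, T₂, w₂, hw₂⟩ : ∃ D' T', β.IsWord k D' T' ∧ ∀ χ ∈ U, ∀ a,
        χ ((((k + 1 : ℕ) : ℂ) • D - ∑ i, d i * S.poissonₗ (s i)) a) = χ (D' a) := by
      refine ih fun χ hχ a ha => ?_
      have h2 := hD χ hχ _ (euler_mem_ker_pow (hU χ hχ) ha)
      rw [← h2]
      simp [hd]
    have hk : ((k + 1 : ℕ) : ℂ) ≠ 0 := Nat.cast_ne_zero.2 k.succ_ne_zero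
    refine ⟨_, _, (w₂.succ.add (IsWord.sum Finset.univ fun i => (w₁ i).mul_ham (s i))).smul
      ((k + 1 : ℕ) : ℂ)⁻¹, fun χ hχ a => ?_⟩
    have h3 := hw₂ χ hχ a
    simp only [LinearMap.smul_apply, LinearMap.add_apply, map_smul, map_add, ← h3,
      LinearMap.sub_apply, LinearMap.sum_apply, Module.End.mul_apply, map_sum, ← hw₁ _ χ hχ,
      map_sub, sub_add_cancel, smul_smul, inv_mul_cancel₀ hk, one_smul]

/-! ### Lifting operators along approximate flat extensions -/

variable (φ) in
/-- The value at `ψ` of the difference between `f` and the pullback of `a`, for `(a, f) : A × B`. -/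
def defect (ψ : B →ₐ[ℂ] ℂ) : A × B →ₗ[ℂ] ℂ :=
  ψ.toLinearMap ∘ₗ LinearMap.snd ℂ A B - (ψ.comp φ).toLinearMap ∘ₗ LinearMap.fst ℂ A B

@[simp]
theorem defect_apply (ψ : B →ₐ[ℂ] ℂ) (n : A × B) : defect φ ψ n = ψ n.2 - ψ (φ n.1) := rfl

variable (β) in
/-- `(a, f) ∈ β.agree ψ m`: at the point of evaluation `ψ`, the function `f` agrees with the
pullback of `a` to order `m`, where `f` is differentiated by `⦃b, ·⦄` and `a` by `{b, ·}`. -/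
def agree (ψ : B →ₐ[ℂ] ℂ) : ℕ → Submodule ℂ (A × B) :=
  (S.selfModule.prod β.poissonModule).contact (defect φ ψ)

theorem mem_agree_succ {ψ : B →ₐ[ℂ] ℂ} {m : ℕ} {a : A} {f : B} :
    (a, f) ∈ β.agree ψ (m + 1) ↔
      ψ f = ψ (φ a) ∧ ∀ b, (S.poisson b a, β.br b f) ∈ β.agree ψ m := by
  rw [agree, PoissonModule.mem_contact_succ]
  refine and_congr ?_ (forall_congr' fun b => ?_)
  · simp [sub_eq_zero]
  · simp [StarProduct.selfModule, poissonModule]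

theorem defect_mul (ψ : B →ₐ[ℂ] ℂ) (a : A) (n : A × B) :
    defect φ ψ ((S.selfModule.prod β.poissonModule).mul a n) = ψ.comp φ a * defect φ ψ n := by
  simp [StarProduct.selfModule, poissonModule, mul_sub]

theorem agree_antitone (ψ : B →ₐ[ℂ] ℂ) : Antitone (β.agree ψ) :=
  PoissonModule.contact_antitone

theorem apply_eq_of_mem_agree {ψ : B →ₐ[ℂ] ℂ} {m : ℕ} (hm : m ≠ 0) {a : A} {f : B}
    (h : (a, f) ∈ β.agree ψ m) : ψ f = ψ (φ a) := by
  obtain ⟨m, rfl⟩ := Nat.exists_eq_succ_of_ne_zero hm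
  exact (mem_agree_succ.1 h).1

theorem mul_mem_agree {ψ : B →ₐ[ℂ] ℂ} {m : ℕ} {a : A} {f : B} (h : (a, f) ∈ β.agree ψ m) (c : A) :
    (c * a, φ c * f) ∈ β.agree ψ m :=
  PoissonModule.mul_mem_contact (defect_mul ψ) c h

theorem mem_agree_of_mul_eq {ψ : B →ₐ[ℂ] ℂ} {c : A} (hc : ψ (φ c) = 1) {a a' : A} {f f' : B}
    (ha : c * a = c * a') (hf : φ c * f = φ c * f') {m : ℕ} (h : (a, f) ∈ β.agree ψ m) :
    (a', f') ∈ β.agree ψ m := by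
  have h1 : (a', f') - (a, f) ∈ β.agree ψ m := by
    refine PoissonModule.mem_contact_of_mul_eq_zero (defect_mul ψ) (a := c) hc ?_ m
    simp [StarProduct.selfModule, poissonModule, mul_sub, ha, hf]
  simpa using add_mem h1 h

/-- Every `f` is, to any finite order at a given point, the pullback of a function on the base. -/
theorem exists_mem_agree {ψ : B →ₐ[ℂ] ℂ} {ι : Type*} [Fintype ι] {y z : ι → A}
    (hy : ∀ i, ψ.comp φ (y i) = 0)
    (hz : ∀ b, b - algebraMap ℂ A (ψ.comp φ b) - ∑ i, ψ.comp φ (S.poisson b (y i)) • z i ∈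
      RingHom.ker (ψ.comp φ) ^ 2) (m : ℕ) (f : B) : ∃ a, (a, f) ∈ β.agree ψ m := by
  obtain ⟨a, ha⟩ := PoissonModule.exists_sub_mem_contact (defect_mul (β := β) ψ) hy hz
    (-LinearMap.inl ℂ A B) (fun a b => by simp [StarProduct.selfModule])
    (by simp) m (0, f)
  refine ⟨a, ?_⟩
  have e : (0, f) - (-LinearMap.inl ℂ A B) a = (a, f) := by simp
  rwa [e] at ha

/-- A word of length `k` differentiates at most `k` times. -/
theorem IsWord.mem_agree {k : ℕ} {D : Module.End ℂ A} {T : Module.End ℂ B} (w : β.IsWord k D T)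
    {ψ : B →ₐ[ℂ] ℂ} {m : ℕ} {a : A} {f : B} (h : (a, f) ∈ β.agree ψ (m + k)) :
    (D a, T f) ∈ β.agree ψ m := by
  induction w generalizing a f with
  | mul c => exact mul_mem_agree h c
  | mul_ham b _ ih => exact ih (by simpa using (mem_agree_succ.1 h).2 b)
  | add _ _ ih ih' => exact add_mem (ih h) (ih' h)
  | smul c _ ih => exact Submodule.smul_mem _ c (ih h)
  | succ _ ih => exact ih (agree_antitone ψ (Nat.le_succ _) h)

end SPBracket

end

/-! ### Hadamard's lemma -/

section Hadamard

open MeasureTheory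

/-- Smoothness of parametric integrals over `[0, 1]`. The integral is written as a convolution in
the variable `t`, at the point `0`, with a bump function supplying the compact support. -/
theorem contDiff_integral_of_contDiff {E W : Type*} [NormedAddCommGroup E] [NormedSpace ℝ E]
    [NormedAddCommGroup W] [NormedSpace ℝ W] {f : ℝ → E → W}
    (hf : ContDiff ℝ ∞ (fun q : E × ℝ => f q.2 q.1)) :
    ContDiff ℝ ∞ (fun x => ∫ t in (0 : ℝ)..1, f t x) := by
  let ψ : ContDiffBump (0 : ℝ) := ⟨1, 2, one_pos, one_lt_two⟩
  let g : E → ℝ → W := fun x u => ψ u • f (-u) x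
  let i : ℝ → ℝ := (Set.Ioc (0 : ℝ) 1).indicator 1
  have hi : LocallyIntegrable i volume :=
    ((integrable_indicator_iff measurableSet_Ioc).2
      (by exact integrableOn_const (by simp))).locallyIntegrable
  have hg : ContDiff ℝ ∞ (fun q : E × ℝ => g q.1 q.2) := by
    have h1 : ContDiff ℝ ∞ (fun q : E × ℝ => ψ q.2) := ψ.contDiff.comp contDiff_snd
    have h2 : ContDiff ℝ ∞ (fun q : E × ℝ => (q.1, -q.2)) := contDiff_fst.prodMk contDiff_snd.neg
    exact h1.smul (hf.comp h2)
  have h := MeasureTheory.contDiffOn_convolution_right_with_param_comp (𝕜 := ℝ) (n := ⊤)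
    (μ := volume) (ContinuousLinearMap.lsmul ℝ ℝ : ℝ →L[ℝ] W →L[ℝ] W) (s := Set.univ)
    (v := fun _ : E => (0 : ℝ)) contDiffOn_const (f := i) (g := g)
    (k := Metric.closedBall 0 2) isOpen_univ (isCompact_closedBall _ _)
    (fun p x _ hx => by
      have : ψ x = 0 := ψ.zero_of_le_dist (not_le.1 hx).le
      simp [g, this]) hi (by exact hg.contDiffOn)
  rw [contDiffOn_univ] at h
  convert h using 2 with x
  rw [convolution_def, intervalIntegral.integral_of_le zero_le_one,
    ← integral_indicator measurableSet_Ioc]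
  congr 1
  ext t
  by_cases ht : t ∈ Set.Ioc (0 : ℝ) 1
  · have h1 : ψ (-t) = 1 :=
      ψ.one_of_mem_closedBall (by simpa [ψ, abs_of_pos ht.1] using ht.2)
    simp [i, g, ht, h1]
  · simp [i, ht]

/-- Hadamard's lemma: a smooth function vanishing at a point is a combination of coordinates. -/
theorem exists_hadamard {E W : Type*} [NormedAddCommGroup E] [NormedSpace ℝ E]
    [NormedAddCommGroup W] [NormedSpace ℝ W] [CompleteSpace W] {g : E → W}
    (hg : ContDiff ℝ ∞ g) (y : E) :
    ∃ G : E → E →L[ℝ] W, ContDiff ℝ ∞ G ∧ ∀ x, g x - g y = G x (x - y) := by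
  have hg' : ContDiff ℝ ∞ (fderiv ℝ g) := hg.fderiv_right (by simp)
  have hF : ContDiff ℝ ∞ (fun q : E × ℝ => fderiv ℝ g (y + q.2 • (q.1 - y))) := by
    fun_prop
  refine ⟨fun x => ∫ t in (0 : ℝ)..1, fderiv ℝ g (y + t • (x - y)),
    contDiff_integral_of_contDiff hF, fun x => ?_⟩
  have hc : Continuous fun t : ℝ => fderiv ℝ g (y + t • (x - y)) :=
    hg'.continuous.comp (by fun_prop)
  rw [ContinuousLinearMap.intervalIntegral_apply (hc.intervalIntegrable _ _)]
  have hd : ∀ t ∈ Set.uIcc (0 : ℝ) 1, HasDerivAt (fun t : ℝ => g (y + t • (x - y)))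
      (fderiv ℝ g (y + t • (x - y)) (x - y)) t := by
    intro t _
    have h1 : HasDerivAt (fun t : ℝ => y + t • (x - y)) (x - y) t := by
      simpa using ((hasDerivAt_id t).smul_const (x - y)).const_add y
    have h2 := (hg.differentiable (by simp) (y + t • (x - y))).hasFDerivAt
    exact h2.comp_hasDerivAt t h1
  rw [intervalIntegral.integral_eq_sub_of_hasDerivAt hd
    ((hc.clm_apply continuous_const).intervalIntegrable _ _)]
  simp

end Hadamard

/-! ### Smooth functions: cutoffs, local inverses and coordinates -/

section Manifolds

variable {E M : Type*} [NormedAddCommGroup E] [NormedSpace ℝ E]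
  [TopologicalSpace M] [ChartedSpace E M]

/-- Evaluation of smooth functions at a point. -/
def evalAt (x : M) : CInf E M →ₐ[ℂ] ℂ :=
  (Pi.evalAlgHom ℂ (fun _ : M => ℂ) x).comp (smoothSubalgebra E M).val

@[simp]
theorem evalAt_apply (x : M) (a : CInf E M) : evalAt x a = a.1 x := rfl

/-- The order of a differential operator may be computed pointwise. -/
theorem isDiffOp_of_pointwise {k : ℕ} {T : Module.End ℂ (CInf E M)}
    (h : ∀ x, ∃ T' : Module.End ℂ (CInf E M), IsDiffOp (AlgHom.id ℂ _) k T' ∧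
      ∀ f, (T f).1 x = (T' f).1 x) : IsDiffOp (AlgHom.id ℂ _) k T := by
  induction k generalizing T with
  | zero =>
    intro a b
    refine Subtype.ext (funext fun x => ?_)
    obtain ⟨T', hT', hx⟩ := h x
    have h1 : ∀ a b, T' (a * b) = a * T' b := hT'
    have h2 : (T (a * b)).1 x = a.1 x * (T b).1 x := by rw [hx, hx, h1]; rfl
    exact h2
  | succ k ih =>
    intro a
    refine ih fun x => ?_
    obtain ⟨T', hT', hx⟩ := h x
    refine ⟨_, hT' a, fun f => ?_⟩
    have h2 : (T (a * f)).1 x - a.1 x * (T f).1 x = (T' (a * f)).1 x - a.1 x * (T' f).1 x := by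
      rw [hx, hx]
    exact h2

variable [FiniteDimensional ℝ E] [T2Space M] [IsManifold 𝓘(ℝ, E) ∞ M]

theorem exists_cutoff {x : M} {s : Set M} (hs : s ∈ nhds x) :
    ∃ c : CInf E M, c.1 =ᶠ[nhds x] 1 ∧ tsupport c.1 ⊆ s := by
  obtain ⟨f, -, hf⟩ := (SmoothBumpFunction.nhds_basis_tsupport (I := 𝓘(ℝ, E)) x).mem_iff.1 hs
  have hc : ContMDiff 𝓘(ℝ, E) 𝓘(ℝ, ℂ) ∞ (fun y => (f y : ℂ)) :=
    Complex.ofRealCLM.contDiff.comp_contMDiff f.contMDiff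
  refine ⟨⟨_, hc⟩, ?_, subset_trans (closure_mono ?_) hf⟩
  · filter_upwards [f.eventuallyEq_one] with y hy
    simp [hy]
  · intro y hy
    simpa using hy

theorem exists_mul_eventuallyEq_one {x : M} {a : CInf E M} (ha : a.1 x ≠ 0) :
    ∃ g : CInf E M, ∀ᶠ y in nhds x, g.1 y * a.1 y = 1 := by
  have hs : {y | a.1 y ≠ 0} ∈ nhds x := (isOpen_ne_fun a.2.continuous continuous_const).mem_nhds ha
  obtain ⟨c, hc, hcs⟩ := exists_cutoff (E := E) hs
  have hg : ContMDiff 𝓘(ℝ, E) 𝓘(ℝ, ℂ) ∞ (fun y => c.1 y * (a.1 y)⁻¹) := by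
    refine contMDiff_of_tsupport fun y hy => ?_
    have hy' : a.1 y ≠ 0 := hcs (tsupport_mul_subset_left hy)
    have h1 : ContMDiffAt 𝓘(ℝ, E) 𝓘(ℝ, ℂ) ∞ (fun y => (a.1 y)⁻¹) y :=
      (contDiffAt_inv ℝ hy').contMDiffAt.comp y a.2.contMDiffAt
    have h2 : ContDiff ℝ ∞ (fun p : ℂ × ℂ => p.1 * p.2) := contDiff_mul
    exact h2.contDiffAt.contMDiffAt.comp y (c.2.contMDiffAt.prodMk_space h1)
  refine ⟨⟨_, hg⟩, ?_⟩
  filter_upwards [hc, hs] with y h1 h2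
  have h2' : a.1 y ≠ 0 := h2
  simp [h1, h2']

/-- Coordinates near `x`, extended to functions on `M`: at each point `y` near `x` their
differentials span the cotangent space, in the form that every function is modulo `I_y ^ 2` an
affine combination of them; and at `x` the differentials are linearly independent over `ℂ`. -/
theorem exists_coordinates (x : M) : ∃ (d : ℕ) (t : Fin d → CInf E M),
    (∀ᶠ y in nhds x, ∀ b : CInf E M, ∃ c : Fin d → ℂ,
      b - algebraMap ℂ (CInf E M) (b.1 y) -
        ∑ i, c i • (t i - algebraMap ℂ (CInf E M) ((t i).1 y)) ∈
          RingHom.ker (evalAt (E := E) y) ^ 2) ∧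
    ∀ v : Fin d → ℂ, mfderiv 𝓘(ℝ, E) 𝓘(ℝ, ℂ) (∑ i, v i • t i : CInf E M).1 x = 0 → v = 0 := by
  let e := extChartAt 𝓘(ℝ, E) x
  let bs := Module.finBasis ℝ E
  let l : Fin (Module.finrank ℝ E) → E →L[ℝ] ℂ := fun i =>
    Complex.ofRealCLM.comp (bs.coord i).toContinuousLinearMap
  obtain ⟨f⟩ : Nonempty (SmoothBumpFunction 𝓘(ℝ, E) x) := inferInstance
  have ht : ∀ i, ContMDiff 𝓘(ℝ, E) 𝓘(ℝ, ℂ) ∞ (fun z => f z • l i (e z)) := fun i =>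
    f.contMDiff_smul ((l i).contMDiff.comp_contMDiffOn contMDiffOn_extChartAt)
  refine ⟨_, fun i => ⟨_, ht i⟩, ?_, fun v hv => ?_⟩
  · filter_upwards [f.eventuallyEq_one.eventually_nhds,
      (chartAt E x).open_source.mem_nhds (mem_chart_source E x)] with y hfy hy b
    have hy' : y ∈ e.source := by simpa [e] using hy
    -- transport `b` to the model space, cut off outside the chart
    obtain ⟨r, hr, hrt⟩ := Metric.nhds_basis_closedBall.mem_iff.1
      ((isOpen_extChartAt_target (I := 𝓘(ℝ, E)) x).mem_nhds (e.map_source hy'))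
    let ψ : ContDiffBump (e y) := ⟨r / 2, r, half_pos hr, half_lt_self hr⟩
    have hg : ContDiff ℝ ∞ (fun ξ => ψ ξ • b.1 (e.symm ξ)) := by
      rw [← contMDiff_iff_contDiff]
      refine contMDiff_of_tsupport fun ξ hξ => ?_
      have hξ' : ξ ∈ e.target := by
        have := tsupport_smul_subset_left (ψ : E → ℝ) _ hξ
        rw [ψ.tsupport_eq] at this
        exact hrt this
      have h1 : ContMDiffAt 𝓘(ℝ, E) 𝓘(ℝ, E) ∞ e.symm ξ :=
        (contMDiffOn_extChartAt_symm x).contMDiffAt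
          ((isOpen_extChartAt_target (I := 𝓘(ℝ, E)) x).mem_nhds hξ')
      exact ψ.contDiff.contMDiff.contMDiffAt.smul (b.2.contMDiffAt.comp ξ h1)
    obtain ⟨G, hG, hG'⟩ := exists_hadamard hg (e y)
    have hec : ContinuousAt e y := continuousAt_extChartAt' hy'
    obtain ⟨c, hc, hcs⟩ := exists_cutoff (E := E) (x := y)
      (Filter.inter_mem (Filter.inter_mem hfy
        ((chartAt E x).open_source.mem_nhds hy)) (hec.preimage_mem_nhds ψ.eventuallyEq_one))
    have hG2 : ∀ i, ContMDiff 𝓘(ℝ, E) 𝓘(ℝ, ℂ) ∞ (fun z => c.1 z * G (e z) (bs i)) := by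
      refine fun i => contMDiff_of_tsupport fun z hz => ?_
      have hz' := hcs (tsupport_mul_subset_left hz)
      have h1 : ContMDiffAt 𝓘(ℝ, E) 𝓘(ℝ, ℂ) ∞ (fun z => G (e z) (bs i)) z :=
        (hG.clm_apply contDiff_const).contDiffAt.contMDiffAt.comp z
          (contMDiffAt_extChartAt' hz'.1.2)
      have h2 : ContDiff ℝ ∞ (fun p : ℂ × ℂ => p.1 * p.2) := contDiff_mul
      exact h2.contDiffAt.contMDiffAt.comp z (c.2.contMDiffAt.prodMk_space h1)
    have hcy : c.1 y = 1 := hc.self_of_nhds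
    let t' : Fin (Module.finrank ℝ E) → CInf E M := fun i => ⟨_, ht i⟩
    let G' : Fin (Module.finrank ℝ E) → CInf E M := fun i => ⟨_, hG2 i⟩
    change ∃ k : Fin (Module.finrank ℝ E) → ℂ, b - algebraMap ℂ (CInf E M) (b.1 y) -
        ∑ i, k i • (t' i - algebraMap ℂ (CInf E M) ((t' i).1 y)) ∈ _
    have key : c * (b - algebraMap ℂ (CInf E M) (b.1 y)) =
        ∑ i, (t' i - algebraMap ℂ (CInf E M) ((t' i).1 y)) * G' i := by
      refine Subtype.ext (funext fun z => ?_)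
      by_cases hz : z ∈ tsupport c.1
      · obtain ⟨⟨hz1, hz2⟩, hz3⟩ := hcs hz
        have hz1' : f z = 1 := hz1
        have hz3' : ψ (e z) = 1 := hz3
        have hfy' : f y = 1 := hfy.self_of_nhds
        have hψ : ψ (e y) = 1 := ψ.eventuallyEq_one.self_of_nhds
        have h1 := hG' (e z)
        have hzs : z ∈ e.source := by simpa [e] using hz2
        rw [hz3', hψ, one_smul, one_smul, e.left_inv hzs, e.left_inv hy',
          ← bs.sum_repr (e z - e y), map_sum] at h1
        simp only [map_smul, Complex.real_smul] at h1
        have h2 : c.1 z * (b.1 z - b.1 y) =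
            ∑ i, (f z • l i (e z) - f y • l i (e y)) * (c.1 z * G (e z) (bs i)) := by
          rw [h1, Finset.mul_sum, hz1', hfy']
          refine Finset.sum_congr rfl fun i _ => ?_
          simp only [l, one_smul, map_sub, Finsupp.sub_apply, Complex.ofReal_sub,
            ContinuousLinearMap.comp_apply,
            LinearMap.coe_toContinuousLinearMap', Module.Basis.coord_apply,
            Complex.ofRealCLM_apply]
          ring
        simpa [t', G'] using h2
      · have : c.1 z = 0 := image_eq_zero_of_notMem_tsupport hz
        simp [G', this]
    refine ⟨fun i => (G' i).1 y, ?_⟩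
    have h1 : (1 - c) * (b - algebraMap ℂ (CInf E M) (b.1 y)) ∈
        RingHom.ker (evalAt (E := E) y) ^ 2 := by
      rw [pow_two]
      exact Ideal.mul_mem_mul (by simp [RingHom.mem_ker, hcy]) (by simp [RingHom.mem_ker])
    have h2 : ∑ i, (t' i - algebraMap ℂ (CInf E M) ((t' i).1 y)) *
        (G' i - algebraMap ℂ (CInf E M) ((G' i).1 y)) ∈ RingHom.ker (evalAt (E := E) y) ^ 2 := by
      rw [pow_two]
      exact sum_mem fun i _ => Ideal.mul_mem_mul (by simp [RingHom.mem_ker])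
        (by simp [RingHom.mem_ker])
    convert add_mem h1 h2 using 1
    have h3 : ∑ i, (t' i - algebraMap ℂ (CInf E M) ((t' i).1 y)) *
        (G' i - algebraMap ℂ (CInf E M) ((G' i).1 y)) =
          ∑ i, (t' i - algebraMap ℂ (CInf E M) ((t' i).1 y)) * G' i -
          ∑ i, (G' i).1 y • (t' i - algebraMap ℂ (CInf E M) ((t' i).1 y)) := by
      rw [← Finset.sum_sub_distrib]
      refine Finset.sum_congr rfl fun i _ => ?_
      rw [Algebra.smul_def]
      ring
    rw [h3, sub_mul, key, one_mul]
    ring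
  · let L : E →L[ℝ] ℂ := ∑ i, v i • l i
    have h1 : (∑ i, v i • (⟨_, ht i⟩ : CInf E M) : CInf E M).1 =ᶠ[nhds x] L ∘ e := by
      filter_upwards [f.eventuallyEq_one] with z hz
      simp [L, hz]
    have h2 : L = 0 := by
      have he := isInvertible_mfderiv_extChartAt (I := 𝓘(ℝ, E))
        (mem_extChartAt_source (I := 𝓘(ℝ, E)) x)
      rw [h1.mfderiv_eq, mfderiv_comp (I' := 𝓘(ℝ, E)) x L.mdifferentiableAt
        (mdifferentiableAt_extChartAt (mem_chart_source E x)), L.mfderiv_eq] at hv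
      ext w
      obtain ⟨u, rfl⟩ := he.bijective.2 w
      exact congrArg (fun T => T u) hv
    ext k
    have h3 : L (bs k) = v k := by
      simp [L, l, Finsupp.single_apply, apply_ite (Complex.ofReal)]
    rw [← h3, h2]
    rfl

end Manifolds

/-! ### Hamiltonian frames -/

section Algebraic

variable {A : Type*} [CommRing A] [Algebra ℂ A] {S : StarProduct A} {χ : A →ₐ[ℂ] ℂ}

theorem poisson_apply_eq_zero_of_mem_sq {a b : A} (hb : b ∈ RingHom.ker χ ^ 2) :
    χ (S.poisson a b) = 0 := by
  rw [pow_two] at hb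
  induction hb using Submodule.mul_induction_on' with
  | mem_mul_mem u hu v hv =>
    have hu' : χ u = 0 := hu
    have hv' : χ v = 0 := hv
    rw [S.poisson_mul, map_add, map_mul, map_mul, hu', hv']
    ring
  | add u _ v _ hu hv => rw [← S.poissonₗ_apply, map_add, map_add, S.poissonₗ_apply,
      S.poissonₗ_apply, hu, hv, add_zero]

theorem poisson_algebraMap (a : A) (c : ℂ) : S.poisson a (algebraMap ℂ A c) = 0 := by
  rw [S.poisson_antisymm, ← S.poissonₗ_apply]
  have h := S.selfModule.ham_algebraMap c
  exact neg_eq_zero.2 (LinearMap.congr_fun h a)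

variable {d : ℕ} {t : Fin d → A}

/-- The matrix of the Poisson tensor at a point, with respect to functions `tᵢ`. -/
def poissonMatrix (S : StarProduct A) (χ : A →ₐ[ℂ] ℂ) (t : Fin d → A) :
    Matrix (Fin d) (Fin d) ℂ :=
  Matrix.of fun j k => χ (S.poisson (t j) (t k))

/-- The Poisson bracket at a point depends on the second argument only through its differential. -/
theorem poisson_apply_eq_sum {b : A} {c : Fin d → ℂ}
    (hc : b - algebraMap ℂ A (χ b) - ∑ i, c i • (t i - algebraMap ℂ A (χ (t i))) ∈
      RingHom.ker χ ^ 2) (a : A) :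
    χ (S.poisson a b) = ∑ i, c i * χ (S.poisson a (t i)) := by
  have h := poisson_apply_eq_zero_of_mem_sq (S := S) (a := a) hc
  rw [← S.poissonₗ_apply] at h
  simp only [map_sub, map_sum, map_smul] at h
  simp only [S.poissonₗ_apply, poisson_algebraMap, map_zero, sub_zero, smul_eq_mul] at h
  exact sub_eq_zero.1 h

variable {Q : Matrix (Fin d) (Fin d) A}

/-- If the `tᵢ` span the cotangent space and `Q` inverts the Poisson tensor, then
`db = ∑ Qᵢⱼ {tⱼ, b} dtᵢ`. -/
theorem frame_of_inverse (hQ : Q.map χ * poissonMatrix S χ t = 1)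
    (ht : ∀ b, ∃ c : Fin d → ℂ, b - algebraMap ℂ A (χ b) -
      ∑ i, c i • (t i - algebraMap ℂ A (χ (t i))) ∈ RingHom.ker χ ^ 2) (b : A) :
    b - algebraMap ℂ A (χ b) - ∑ p : Fin d × Fin d,
      (χ (Q p.1 p.2) * χ (S.poisson (t p.2) b)) • (t p.1 - algebraMap ℂ A (χ (t p.1))) ∈
        RingHom.ker χ ^ 2 := by
  obtain ⟨c, hc⟩ := ht b
  have h : ∀ i, ∑ j, χ (Q i j) * χ (S.poisson (t j) b) = c i := by
    intro i
    have h1 := congrFun (congrArg (fun m => m.mulVec c) hQ) i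
    simp only [← Matrix.mulVec_mulVec, Matrix.one_mulVec] at h1
    rw [← h1]
    simp only [Matrix.mulVec, dotProduct, poissonMatrix, Matrix.of_apply, Matrix.map_apply,
      poisson_apply_eq_sum hc, mul_comm (c _)]
  convert hc using 2
  rw [Fintype.sum_prod_type]
  refine Finset.sum_congr rfl fun i _ => ?_
  rw [← h i, Finset.sum_smul]

/-- The frame of `frame_of_inverse`, read with the roles of the two factors exchanged: the functions
`χ (Qᵢⱼ) (tᵢ - tᵢ(x))` and `tⱼ - tⱼ(x)` have dual differentials with respect to the Poisson
tensor. -/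
theorem dual_frame_of_inverse (hQ : Q.map χ * poissonMatrix S χ t = 1)
    (ht : ∀ b, ∃ c : Fin d → ℂ, b - algebraMap ℂ A (χ b) -
      ∑ i, c i • (t i - algebraMap ℂ A (χ (t i))) ∈ RingHom.ker χ ^ 2) (b : A) :
    b - algebraMap ℂ A (χ b) - ∑ p : Fin d × Fin d,
      χ (S.poisson b (χ (Q p.1 p.2) • (t p.1 - algebraMap ℂ A (χ (t p.1))))) •
        (t p.2 - algebraMap ℂ A (χ (t p.2))) ∈ RingHom.ker χ ^ 2 := by
  obtain ⟨c, hc⟩ := ht b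
  have h : ∀ j, ∑ i, χ (S.poisson b (χ (Q i j) • (t i - algebraMap ℂ A (χ (t i))))) = c j := by
    intro j
    have h1 := congrFun (congrArg (fun m => Matrix.vecMul c m) (mul_eq_one_comm.1 hQ)) j
    simp only [← Matrix.vecMul_vecMul, Matrix.vecMul_one] at h1
    rw [← h1]
    simp only [Matrix.vecMul, dotProduct, poissonMatrix, Matrix.of_apply, Matrix.map_apply]
    refine Finset.sum_congr rfl fun i _ => ?_
    rw [← S.poissonₗ_apply, map_smul, map_sub, S.poissonₗ_apply, S.poissonₗ_apply,
      poisson_algebraMap, sub_zero, map_smul, smul_eq_mul, mul_comm, S.poisson_antisymm, map_neg,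
      poisson_apply_eq_sum hc, ← Finset.sum_neg_distrib]
    refine congrArg (· * _) (Finset.sum_congr rfl fun k _ => ?_)
    rw [S.poisson_antisymm, map_neg, mul_neg, neg_neg]
  convert hc using 2
  rw [Fintype.sum_prod_type_right]
  refine Finset.sum_congr rfl fun j _ => ?_
  rw [← h j, Finset.sum_smul]

end Algebraic

section Manifolds

variable {E M : Type*} [NormedAddCommGroup E] [NormedSpace ℝ E]
  [TopologicalSpace M] [ChartedSpace E M]
  [FiniteDimensional ℝ E] [T2Space M] [IsManifold 𝓘(ℝ, E) ∞ M]

/-- On a symplectic manifold, coordinates near a point and the inverse of the Poisson tensor. -/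
theorem StarProduct.IsSymplectic.exists_inverse {S : StarProduct (CInf E M)} (hS : S.IsSymplectic)
    (x : M) : ∃ (d : ℕ) (t : Fin d → CInf E M) (Q : Matrix (Fin d) (Fin d) (CInf E M)),
    ∀ᶠ y in nhds x, Q.map (evalAt y) * poissonMatrix S (evalAt y) t = 1 ∧
      ∀ b, ∃ c : Fin d → ℂ, b - algebraMap ℂ (CInf E M) (evalAt y b) -
        ∑ i, c i • (t i - algebraMap ℂ (CInf E M) (evalAt y (t i))) ∈
          RingHom.ker (evalAt (E := E) y) ^ 2 := by
  obtain ⟨d, t, ht, hx⟩ := exists_coordinates (E := E) x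
  let G : Matrix (Fin d) (Fin d) (CInf E M) := Matrix.of fun j k => S.poisson (t j) (t k)
  have hG : ∀ y, G.map (evalAt y) = poissonMatrix S (evalAt y) t := fun y => rfl
  have hdet : G.det.1 x ≠ 0 := by
    intro h0
    have h1 : (poissonMatrix S (evalAt x) t).det = 0 := by
      rw [← hG, ← AlgHom.mapMatrix_apply, ← AlgHom.map_det]
      exact h0
    obtain ⟨v, hv, hv'⟩ := Matrix.exists_mulVec_eq_zero_iff.2 h1
    refine hv (hx v (hS x _ fun b => ?_))
    obtain ⟨c, hc⟩ := ht.self_of_nhds b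
    have h2 : ∀ j, evalAt x (S.poisson (t j) b) =
        -∑ k, c k * poissonMatrix S (evalAt x) t k j := by
      intro j
      rw [poisson_apply_eq_sum (χ := evalAt x) hc, ← Finset.sum_neg_distrib]
      refine Finset.sum_congr rfl fun k _ => ?_
      rw [S.poisson_antisymm, map_neg, mul_neg]
      rfl
    have h3 : evalAt x (S.poisson (∑ i, v i • t i) b) = 0 := by
      have h5 : S.poisson (∑ i, v i • t i) b = ∑ i, v i • S.poisson (t i) b := by
        simp only [← S.poissonₗ_apply, map_sum, map_smul, LinearMap.sum_apply,
          LinearMap.smul_apply]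
      simp only [h5, map_sum, map_smul, h2, smul_eq_mul, mul_neg, Finset.sum_neg_distrib,
        Finset.mul_sum]
      rw [Finset.sum_comm, neg_eq_zero]
      refine Finset.sum_eq_zero fun k _ => ?_
      have h4 := congrFun hv' k
      simp only [Matrix.mulVec, dotProduct, Pi.zero_apply] at h4
      rw [← mul_zero (c k), ← h4, Finset.mul_sum]
      exact Finset.sum_congr rfl fun j _ => by ring
    exact h3
  obtain ⟨q, hq⟩ := exists_mul_eventuallyEq_one hdet
  refine ⟨d, t, q • G.adjugate, ?_⟩
  filter_upwards [hq, ht] with y h1 h2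
  refine ⟨?_, h2⟩
  rw [← hG, ← AlgHom.mapMatrix_apply, ← AlgHom.mapMatrix_apply, ← map_mul, Matrix.smul_mul,
    Matrix.adjugate_mul, smul_smul]
  ext i j
  have h3 : evalAt y (q * G.det) = 1 := h1
  simp only [AlgHom.mapMatrix_apply, Matrix.map_apply, Matrix.smul_apply, smul_eq_mul,
    map_mul] at h3 ⊢
  rw [h3, one_mul, Matrix.one_apply, Matrix.one_apply, apply_ite (evalAt y), map_one, map_zero]

end Manifolds

/-! ### The lift of differential operators -/

section Manifolds

variable {E M F P : Type*}
  [NormedAddCommGroup E] [NormedSpace ℝ E]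
  [TopologicalSpace M] [ChartedSpace E M] [IsManifold 𝓘(ℝ, E) ∞ M]
  [NormedAddCommGroup F] [NormedSpace ℝ F]
  [TopologicalSpace P] [ChartedSpace F P] [IsManifold 𝓘(ℝ, F) ∞ P]
  {pr : P → M} {hpr : IsFibered E F pr} {S : StarProduct (CInf E M)}

namespace SPBracket

variable {β : SPBracket S hpr.pullback}

/-- `β.Lifts D T`: up to a loss of finitely many orders, `D` and `T` send approximately equal
functions to approximately equal functions. -/
def Lifts (β : SPBracket S hpr.pullback) (D : Module.End ℂ (CInf E M))
    (T : Module.End ℂ (CInf F P)) : Prop :=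
  ∃ k, ∀ (p : P) (m : ℕ) (a : CInf E M) (f : CInf F P),
    (a, f) ∈ β.agree (evalAt p) (m + k) → (D a, T f) ∈ β.agree (evalAt p) m

theorem IsWord.lifts {k : ℕ} {D : Module.End ℂ (CInf E M)} {T : Module.End ℂ (CInf F P)}
    (w : β.IsWord k D T) : β.Lifts D T :=
  ⟨k, fun _ _ _ _ h => w.mem_agree h⟩

theorem Lifts.add {D D' : Module.End ℂ (CInf E M)} {T T' : Module.End ℂ (CInf F P)}
    (h : β.Lifts D T) (h' : β.Lifts D' T') : β.Lifts (D + D') (T + T') := by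
  obtain ⟨k, hk⟩ := h
  obtain ⟨k', hk'⟩ := h'
  exact ⟨k + k', fun p m a f haf => add_mem
    (hk p m a f (agree_antitone _ (by omega) haf))
    (hk' p m a f (agree_antitone _ (by omega) haf))⟩

theorem Lifts.mul {D D' : Module.End ℂ (CInf E M)} {T T' : Module.End ℂ (CInf F P)}
    (h : β.Lifts D T) (h' : β.Lifts D' T') : β.Lifts (D * D') (T * T') := by
  obtain ⟨k, hk⟩ := h
  obtain ⟨k', hk'⟩ := h'
  exact ⟨k + k', fun p m a f haf => hk p m _ _ (hk' p (m + k) a f (by rwa [add_assoc]))⟩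

theorem Lifts.algebraMap (c : ℂ) :
    β.Lifts (algebraMap ℂ (Module.End ℂ (CInf E M)) c)
      (algebraMap ℂ (Module.End ℂ (CInf F P)) c) :=
  ⟨0, fun _ _ _ _ h => Submodule.smul_mem _ c h⟩

variable [FiniteDimensional ℝ E] [T2Space M]

/-- Every function on `P` has, at each point and to each order, an approximate flat extension. -/
theorem exists_mem_agree_evalAt (hS : S.IsSymplectic) (β : SPBracket S hpr.pullback) (p : P)
    (m : ℕ) (f : CInf F P) : ∃ a, (a, f) ∈ β.agree (evalAt p) m := by
  obtain ⟨d, t, Q, h⟩ := hS.exists_inverse (pr p)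
  obtain ⟨hQ, ht⟩ := h.self_of_nhds
  exact exists_mem_agree (ψ := evalAt p) (β := β)
    (y := fun q : Fin d × Fin d => evalAt (pr p) (Q q.1 q.2) •
      (t q.1 - algebraMap ℂ (CInf E M) (evalAt (pr p) (t q.1))))
    (z := fun q => t q.2 - algebraMap ℂ (CInf E M) (evalAt (pr p) (t q.2)))
    (fun q => show evalAt (pr p) _ = 0 by simp)
    (fun b => dual_frame_of_inverse hQ ht b) m f

/-- Every differential operator on a symplectic manifold is, near each point, a word. -/
theorem exists_isWord_near (hS : S.IsSymplectic) (β : SPBracket S hpr.pullback) {k : ℕ}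
    {D : Module.End ℂ (CInf E M)} (hD : IsDiffOp (AlgHom.id ℂ _) k D) (x : M) :
    ∃ U ∈ nhds x, ∃ D' T', β.IsWord k D' T' ∧ ∀ y ∈ U, ∀ a, (D a).1 y = (D' a).1 y := by
  obtain ⟨d, t, Q, h⟩ := hS.exists_inverse x
  obtain ⟨D', T', w, hw⟩ := exists_isWord (β := β) (D := D) (k := k)
    (t := fun q : Fin d × Fin d => t q.1) (h := fun q => Q q.1 q.2) (s := fun q => t q.2)
    (U := evalAt '' {y | Q.map (evalAt y) * poissonMatrix S (evalAt y) t = 1 ∧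
      ∀ b, ∃ c : Fin d → ℂ, b - algebraMap ℂ (CInf E M) (evalAt y b) -
        ∑ i, c i • (t i - algebraMap ℂ (CInf E M) (evalAt y (t i))) ∈
          RingHom.ker (evalAt (E := E) y) ^ 2})
    (by rintro _ ⟨y, ⟨hQ, ht⟩, rfl⟩ b; exact frame_of_inverse hQ ht b)
    (fun χ _ a ha => hD.apply_eq_zero χ ha)
  exact ⟨_, h, D', T', w, fun y hy a => hw _ ⟨y, hy, rfl⟩ a⟩

theorem Lifts.unique (hS : S.IsSymplectic) {D : Module.End ℂ (CInf E M)}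
    {T T' : Module.End ℂ (CInf F P)} (h : β.Lifts D T) (h' : β.Lifts D T') : T = T' := by
  obtain ⟨k, hk⟩ := h
  obtain ⟨k', hk'⟩ := h'
  refine LinearMap.ext fun f => Subtype.ext (funext fun p => ?_)
  obtain ⟨a, ha⟩ := exists_mem_agree_evalAt hS β p (1 + (k + k')) f
  have h1 := apply_eq_of_mem_agree one_ne_zero (hk p 1 a f (agree_antitone _ (by omega) ha))
  have h2 := apply_eq_of_mem_agree one_ne_zero (hk' p 1 a f (agree_antitone _ (by omega) ha))
  exact h1.trans h2.symm

/-- Every differential operator of order `k` on the base lifts: the words representing it locally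
lift, and their lifts agree where they overlap because every function has approximate flat
extensions. -/
theorem exists_lifts (hS : S.IsSymplectic) {l : ℕ}
    (hl : ∀ b, IsDiffOp (AlgHom.id ℂ _) l (β.br b)) {k : ℕ}
    {D : Module.End ℂ (CInf E M)} (hD : IsDiffOp (AlgHom.id ℂ _) k D) :
    ∃ T : Module.End ℂ (CInf F P), IsDiffOp (AlgHom.id ℂ _) (k * l) T ∧ β.Lifts D T := by
  choose U hU D' T' w hw using exists_isWord_near hS β hD
  have key : ∀ x p f, pr p ∈ U x → (T' (pr p) f).1 p = (T' x f).1 p := by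
    intro x p f hx
    obtain ⟨a, ha⟩ := exists_mem_agree_evalAt hS β p (1 + k) f
    have h1 : (T' (pr p) f).1 p = (D' (pr p) a).1 (pr p) :=
      apply_eq_of_mem_agree one_ne_zero ((w (pr p)).mem_agree ha)
    have h2 : (T' x f).1 p = (D' x a).1 (pr p) :=
      apply_eq_of_mem_agree one_ne_zero ((w x).mem_agree ha)
    rw [h1, h2, ← hw _ _ (mem_of_mem_nhds (hU _)), ← hw _ _ hx]
  have hsmooth : ∀ f : CInf F P, ContMDiff 𝓘(ℝ, F) 𝓘(ℝ, ℂ) ∞ (fun p => (T' (pr p) f).1 p) := by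
    intro f p
    refine ((T' (pr p) f).2 p).congr_of_eventuallyEq ?_
    filter_upwards [hpr.smooth.continuous.continuousAt.preimage_mem_nhds (hU (pr p))] with q hq
    exact key _ _ f hq
  let T : Module.End ℂ (CInf F P) :=
    { toFun f := ⟨_, hsmooth f⟩
      map_add' f g := Subtype.ext (funext fun p => by simp)
      map_smul' c f := Subtype.ext (funext fun p => by simp) }
  refine ⟨T, isDiffOp_of_pointwise fun p => ⟨T' (pr p), (w (pr p)).isDiffOp hl, fun f => rfl⟩,
    k, fun p m a f haf => ?_⟩
  obtain ⟨c, hc, hcU⟩ := exists_cutoff (E := E) (hU (pr p))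
  refine mem_agree_of_mul_eq (c := c) hc.self_of_nhds ?_ ?_ ((w (pr p)).mem_agree haf)
  · refine Subtype.ext (funext fun y => ?_)
    change c.1 y * (D' (pr p) a).1 y = c.1 y * (D a).1 y
    by_cases hy : y ∈ tsupport c.1
    · rw [hw _ y (hcU hy)]
    · rw [image_eq_zero_of_notMem_tsupport hy, zero_mul, zero_mul]
  · refine Subtype.ext (funext fun q => ?_)
    change c.1 (pr q) * (T' (pr p) f).1 q = c.1 (pr q) * (T' (pr q) f).1 q
    by_cases hq : pr q ∈ tsupport c.1
    · rw [key _ q f (hcU hq)]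
    · rw [image_eq_zero_of_notMem_tsupport hq, zero_mul, zero_mul]

/-- The algebra morphism lifting differential operators from the base to the total space, together
with a bound for the orders. -/
theorem exists_isLift (hS : S.IsSymplectic) (β : SPBracket S hpr.pullback) :
    ∃ Φ : DiffOp (CInf E M) →ₐ[ℂ] DiffOp (CInf F P), β.IsLift Φ ∧
      ∃ l : ℕ, ∀ k D, IsDiffOp (AlgHom.id ℂ _) k D.1 →
        IsDiffOp (AlgHom.id ℂ _) (k * l) (Φ D).1 := by
  obtain ⟨_, l, -, hl⟩ := β.bidiff
  have h := fun D : DiffOp (CInf E M) => D.2.elim fun k hD =>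
    (exists_lifts hS hl hD).imp fun T hT => (⟨⟨_, hT.1⟩, hT.2⟩ : T ∈ DiffOp _ ∧ β.Lifts D.1 T)
  choose T hT hlift using h
  let Φ : DiffOp (CInf E M) →ₐ[ℂ] DiffOp (CInf F P) := AlgHom.ofLinearMap
    { toFun D := ⟨T D, hT D⟩
      map_add' D D' := Subtype.ext ((hlift _).unique hS ((hlift D).add (hlift D')))
      map_smul' c D := Subtype.ext ((hlift _).unique hS (by
        have h1 := (Lifts.algebraMap (β := β) c).mul (hlift D)
        rwa [← Algebra.smul_def, ← Algebra.smul_def] at h1)) }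
    (Subtype.ext ((hlift 1).unique hS (by simpa using Lifts.algebraMap (β := β) 1)))
    (fun D D' => Subtype.ext ((hlift _).unique hS ((hlift D).mul (hlift D'))))
  refine ⟨Φ, ⟨fun a => Subtype.ext ((hlift _).unique hS (IsWord.mul a).lifts), fun a =>
    (hlift _).unique hS ?_⟩, l, fun k D hD => ?_⟩
  · have h1 := ((IsWord.mul (β := β) 1).mul_ham a).lifts
    rw [coe_ham]
    convert h1 using 1
    · ext; simp
    · ext; simp
  -- the chosen lift need not come with the bound for this `k`, but agrees with one that does
  · obtain ⟨T', h1, h2⟩ := exists_lifts hS hl hD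
    have h3 : (Φ D).1 = T' := (hlift D).unique hS h2
    rw [h3]
    exact h1

/-- The lift is unique, since differential operators are local and locally words. -/
theorem IsLift.unique (hS : S.IsSymplectic) {Φ Ψ : DiffOp (CInf E M) →ₐ[ℂ] DiffOp (CInf F P)}
    (hΦ : β.IsLift Φ) (hΨ : β.IsLift Ψ) : Ψ = Φ := by
  refine AlgHom.ext fun D => Subtype.ext (LinearMap.ext fun f => Subtype.ext (funext fun p => ?_))
  obtain ⟨k, hD⟩ := D.2
  obtain ⟨U, hU, D', T', w, hw⟩ := exists_isWord_near hS β hD (pr p)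
  obtain ⟨c, hc, hcU⟩ := exists_cutoff (E := E) hU
  obtain ⟨hD', h'⟩ := w.exists_isLift_apply
  have h1 : mulOp c * D = mulOp c * ⟨D', hD'⟩ := by
    refine Subtype.ext (LinearMap.ext fun a => Subtype.ext (funext fun y => ?_))
    change c.1 y * (D.1 a).1 y = c.1 y * (D' a).1 y
    by_cases hy : y ∈ tsupport c.1
    · rw [hw _ (hcU hy)]
    · rw [image_eq_zero_of_notMem_tsupport hy, zero_mul, zero_mul]
  have h2 : ∀ Θ, β.IsLift Θ → ((Θ D).1 f).1 p = (T' f).1 p := by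
    intro Θ hΘ
    have h3 := congrArg Θ h1
    rw [map_mul, map_mul, hΘ.1] at h3
    have h4 : c.1 (pr p) * ((Θ D).1 f).1 p = c.1 (pr p) * ((Θ ⟨D', hD'⟩).1 f).1 p :=
      congrArg (fun T : DiffOp (CInf F P) => (T.1 f).1 p) h3
    rw [hc.self_of_nhds, Pi.one_apply, one_mul, one_mul, h' Θ hΘ] at h4
    exact h4
  rw [h2 Ψ hΨ, h2 Φ hΦ]

end SPBracket

end Manifolds

/-! ### The bimodule deformation -/

section Algebraic

variable {A B : Type*} [CommRing A] [Algebra ℂ A] [CommRing B] [Algebra ℂ B]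

/-- A family `E` of differential operators on `A`, depending linearly on an element of `A`, mapped
to a family of operators on `B` by `Φ`. -/
def mapFamily (Φ : DiffOp A →ₐ[ℂ] DiffOp B) (E : A →ₗ[ℂ] DiffOp A) : A →ₗ[ℂ] B →ₗ[ℂ] B :=
  (DiffOp B).val.toLinearMap ∘ₗ Φ.toLinearMap ∘ₗ E

@[simp]
theorem mapFamily_apply (Φ : DiffOp A →ₐ[ℂ] DiffOp B) (E : A →ₗ[ℂ] DiffOp A) (a : A) (f : B) :
    mapFamily Φ E a f = (Φ (E a)).1 f := rfl

/-- If `a ↦ E a` is a differential operator, then so is `a ↦ Φ (E a)`: commutators with functions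
`c` correspond to the family `a ↦ E (c * a) - c ∘ E a`. -/
theorem isDiffOp_mapFamily_flip {φ : A →ₐ[ℂ] B} {Φ : DiffOp A →ₐ[ℂ] DiffOp B}
    (hΦ : ∀ a, Φ (mulOp a) = mulOp (φ a)) {k : ℕ} {E : A →ₗ[ℂ] DiffOp A}
    (hE : ∀ v, IsDiffOp (AlgHom.id ℂ A) k (((DiffOp A).val.toLinearMap ∘ₗ E).flip v)) (f : B) :
    IsDiffOp φ k ((mapFamily Φ E).flip f) := by
  induction k generalizing E with
  | zero =>
    intro a b
    have h1 : ∀ v a b, (E (a * b)).1 v = a * (E b).1 v := hE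
    have h2 : E (a * b) = mulOp a * E b := Subtype.ext (LinearMap.ext fun v => h1 v a b)
    rw [LinearMap.flip_apply, LinearMap.flip_apply, mapFamily_apply, mapFamily_apply, h2, map_mul,
      hΦ]
    rfl
  | succ k ih =>
    intro c
    let E' : A →ₗ[ℂ] DiffOp A :=
      E ∘ₗ LinearMap.mulLeft ℂ c + (-1 : ℂ) • LinearMap.mulLeft ℂ (mulOp c) ∘ₗ E
    have hE' : ∀ v, IsDiffOp (AlgHom.id ℂ A) k (((DiffOp A).val.toLinearMap ∘ₗ E').flip v) := by
      intro v
      convert hE v c using 1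
      ext a
      change (E (c * a)).1 v + (-1 : ℂ) • (c * (E a).1 v) = (E (c * a)).1 v - c * (E a).1 v
      rw [neg_one_smul, sub_eq_add_neg]
    convert ih hE' using 1
    ext a
    have h : Φ (E' a) = Φ (E (c * a)) + (-1 : ℂ) • (mulOp (φ c) * Φ (E a)) := by
      rw [← hΦ, ← map_mul, ← map_smul, ← map_add]
      rfl
    rw [LinearMap.flip_apply, mapFamily_apply, h]
    change (Φ (E (c * a))).1 f - φ c * (Φ (E a)).1 f =
      (Φ (E (c * a))).1 f + (-1 : ℂ) • (φ c * (Φ (E a)).1 f)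
    rw [neg_one_smul, sub_eq_add_neg]

namespace StarProduct

variable (S : StarProduct A)

/-- `S.leftOp k` as a linear map. -/
def leftOpₗ (k : ℕ) : A →ₗ[ℂ] DiffOp A where
  toFun := S.leftOp k
  map_add' a b := Subtype.ext (map_add (S.C k) a b)
  map_smul' c a := Subtype.ext (map_smul (S.C k) c a)

/-- `S.rightOp k` as a linear map. -/
def rightOpₗ (k : ℕ) : A →ₗ[ℂ] DiffOp A where
  toFun := S.rightOp k
  map_add' a b := Subtype.ext (map_add (S.C k).flip a b)
  map_smul' c a := Subtype.ext (map_smul (S.C k).flip c a)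

@[simp]
theorem leftOpₗ_apply (k : ℕ) (a : A) : S.leftOpₗ k a = S.leftOp k a := rfl

@[simp]
theorem rightOpₗ_apply (k : ℕ) (a : A) : S.rightOpₗ k a = S.rightOp k a := rfl

@[simp]
theorem leftOp_apply (k : ℕ) (a b : A) : (S.leftOp k a).1 b = S.C k a b := rfl

@[simp]
theorem rightOp_apply (k : ℕ) (a b : A) : (S.rightOp k a).1 b = S.C k b a := rfl

theorem leftOp_zero (a : A) : S.leftOp 0 a = mulOp a :=
  Subtype.ext (LinearMap.ext fun b => S.zeroth a b)

theorem rightOp_zero (a : A) : S.rightOp 0 a = mulOp a :=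
  Subtype.ext (LinearMap.ext fun b => (S.zeroth b a).trans (mul_comm b a))

theorem leftOp_one (k : ℕ) : S.leftOp k 1 = if k = 0 then 1 else 0 := by
  refine Subtype.ext (LinearMap.ext fun b => (S.C_one_left k b).trans ?_)
  split <;> rfl

theorem rightOp_one (k : ℕ) : S.rightOp k 1 = if k = 0 then 1 else 0 := by
  refine Subtype.ext (LinearMap.ext fun b => (S.C_one_right k b).trans ?_)
  split <;> rfl

open Finset.HasAntidiagonal

theorem sum_leftOp_C (n : ℕ) (a b : A) :
    ∑ p ∈ antidiagonal n, S.leftOp p.1 (S.C p.2 a b) =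
      ∑ p ∈ antidiagonal n, S.leftOp p.1 a * S.leftOp p.2 b := by
  refine Subtype.ext (LinearMap.ext fun c => ?_)
  simpa [LinearMap.sum_apply] using S.sum_assoc n a b c

theorem sum_rightOp_C (n : ℕ) (a b : A) :
    ∑ p ∈ antidiagonal n, S.rightOp p.1 (S.C p.2 a b) =
      ∑ p ∈ antidiagonal n, S.rightOp p.1 b * S.rightOp p.2 a := by
  refine Subtype.ext (LinearMap.ext fun c => ?_)
  simpa [LinearMap.sum_apply] using (S.sum_assoc n c a b).symm

theorem sum_rightOp_leftOp (n : ℕ) (a b : A) :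
    ∑ p ∈ antidiagonal n, S.rightOp p.1 b * S.leftOp p.2 a =
      ∑ p ∈ antidiagonal n, S.leftOp p.1 a * S.rightOp p.2 b := by
  refine Subtype.ext (LinearMap.ext fun c => ?_)
  simpa [LinearMap.sum_apply] using S.sum_assoc n a c b

/-- A morphism `Φ` of algebras of differential operators that extends `φ` and increases orders at
most by a factor maps the left and right multiplications of a star product to a bimodule
deformation: the axioms are identities between differential operators on `A`. -/
def bimoduleDeformation {φ : A →ₐ[ℂ] B} (Φ : DiffOp A →ₐ[ℂ] DiffOp B)
    (hΦ : ∀ a, Φ (mulOp a) = mulOp (φ a)) (l : ℕ)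
    (hl : ∀ k D, IsDiffOp (AlgHom.id ℂ A) k D.1 → IsDiffOp (AlgHom.id ℂ B) (k * l) (Φ D).1) :
    BimoduleDeformation S φ where
  L k := mapFamily Φ (S.leftOpₗ k)
  R k := (mapFamily Φ (S.rightOpₗ k)).flip
  bidiff_L k := by
    obtain ⟨i, j, h1, h2⟩ := S.bidiff k
    exact ⟨i, j * l, isDiffOp_mapFamily_flip hΦ h1, fun a => hl j (S.leftOp k a) (h2 a)⟩
  bidiff_R k := by
    obtain ⟨i, j, h1, h2⟩ := S.bidiff k
    exact ⟨i * l, j, fun a => hl i (S.rightOp k a) (h1 a), isDiffOp_mapFamily_flip hΦ h2⟩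
  zeroth_L a f := by
    change (Φ (S.leftOp 0 a)).1 f = _
    rw [S.leftOp_zero, hΦ]
    rfl
  zeroth_R f a := by
    change (Φ (S.rightOp 0 a)).1 f = _
    rw [S.rightOp_zero, hΦ]
    rfl
  one_act f := by
    ext n
    rw [← map_one PowerSeries.C, coeff_formalExt_C, Finset.sum_eq_single (0, n)]
    · change (Φ (S.leftOp 0 1)).1 _ = _
      rw [S.leftOp_one, if_pos rfl, map_one]
      rfl
    · rintro ⟨i, j⟩ h hne
      have hi : i ≠ 0 := by
        rintro rfl
        simp at h; simp [h] at hne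
      change (Φ (S.leftOp i 1)).1 _ = _
      rw [S.leftOp_one, if_neg hi, map_zero]
      rfl
    · simp
  act_one f := by
    ext n
    rw [← map_one PowerSeries.C, coeff_formalExt_C_right, Finset.sum_eq_single (0, n)]
    · change (Φ (S.rightOp 0 1)).1 _ = _
      rw [S.rightOp_one, if_pos rfl, map_one]
      rfl
    · rintro ⟨i, j⟩ h hne
      have hi : i ≠ 0 := by
        rintro rfl
        simp at h; simp [h] at hne
      change (Φ (S.rightOp i 1)).1 _ = _
      rw [S.rightOp_one, if_neg hi, map_zero]
      rfl
    · simp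
  star_act := formalExt_assoc_of_coeff _ _ _ _ fun n a b f => by
    have h := congrArg (fun D : DiffOp A => (Φ D).1 f) (S.sum_leftOp_C n a b)
    simpa [LinearMap.sum_apply] using h
  act_star f a b := (formalExt_assoc_of_coeff _ _ _ _ (fun n f a b => by
    have h := congrArg (fun D : DiffOp A => (Φ D).1 f) (S.sum_rightOp_C n a b)
    simpa [LinearMap.sum_apply] using h.symm) f a b).symm
  act_act := formalExt_assoc_of_coeff _ _ _ _ fun n a f b => by
    have h := congrArg (fun D : DiffOp A => (Φ D).1 f) (S.sum_rightOp_leftOp n a b)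
    simpa [LinearMap.sum_apply] using h

end StarProduct

end Algebraic

end FiberedDeformation

end

theorem mainTheorem4 {E M F P : Type*}
    [NormedAddCommGroup E] [NormedSpace ℝ E] [FiniteDimensional ℝ E]
    [TopologicalSpace M] [T2Space M] [SecondCountableTopology M]
    [ChartedSpace E M] [IsManifold 𝓘(ℝ, E) ∞ M]
    [NormedAddCommGroup F] [NormedSpace ℝ F] [FiniteDimensional ℝ F]
    [TopologicalSpace P] [T2Space P] [SecondCountableTopology P]
    [ChartedSpace F P] [IsManifold 𝓘(ℝ, F) ∞ P]
    (pr : P → M) (hpr : FiberedDeformation.IsFibered E F pr)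
    (S : FiberedDeformation.StarProduct (FiberedDeformation.CInf E M)) (hS : S.IsSymplectic)
    (β : FiberedDeformation.SPBracket S hpr.pullback) :
    ∃ Φ : FiberedDeformation.DiffOp (FiberedDeformation.CInf E M) →ₐ[ℂ]
        FiberedDeformation.DiffOp (FiberedDeformation.CInf F P),
      β.IsLift Φ ∧ (∀ Ψ, β.IsLift Ψ → Ψ = Φ) ∧
      ∃ W : FiberedDeformation.BimoduleDeformation S hpr.pullback,
        (∀ (k : ℕ) (a : FiberedDeformation.CInf E M) (f : FiberedDeformation.CInf F P),
          W.L k a f = (Φ (S.leftOp k a)).1 f) ∧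
        (∀ (k : ℕ) (f : FiberedDeformation.CInf F P) (a : FiberedDeformation.CInf E M),
          W.R k f a = (Φ (S.rightOp k a)).1 f) := by
  obtain ⟨Φ, hΦ, l, hl⟩ := FiberedDeformation.SPBracket.exists_isLift hS β
  exact ⟨Φ, hΦ, fun Ψ hΨ => hΦ.unique hS hΨ, S.bimoduleDeformation Φ hΦ.1 l hl,
    fun _ _ _ => rfl, fun _ _ _ => rfl⟩
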